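/- Let $0\le k\le n$. Let $\Lambda_k$ be the space of $k$-vectors of $\mathbb{R}^n$ with its Euclidean norm, $\Lambda^k=(\Lambda_k)^*$, and let $\mathcal{H}^k$ be the $k$-dimensional Hausdorff measure. A set $S\subset\mathbb{R}^n$ is $k$-rectifiable if, up to an $\mathcal{H}^k$-null set, it is covered by countably many Lipschitz images of $\mathbb{R}^k$. An orientation of an $\mathcal{H}^k$-measurable $k$-rectifiable set $S$ is a field $\tau:S\to\Lambda_k$ for which $S=S_{\mathrm{reg}}\cup S_{\mathrm{sing}}$, where $\mathcal{H}^k(S_{\mathrm{sing}})=0$, $S_{\mathrm{reg}}$ is a countable disjoint union of measurable pieces of $k$-dimensional embedded $\mathscr{C}^1$ submanifolds, $\tau|_{S_{\mathrm{reg}}}$ is continuous, and for $x\in S_{\mathrm{reg}}$ the $k$-vector $\tau(x)$ is unit, simple and spans the tangent space of the corresponding submanifold at $x$. For a compact set $E\subset\mathbb{R}^n$, a continuous $k$-form $\omega\in\mathscr{C}^0(E,\Lambda^k)$ and an oriented $\mathcal{H}^k$-measurable $k$-rectifiable $S\subset E$ with $0<\mathcal{H}^k(S)<\infty$, put $$\int_S\omega=\int_S\langle\omega(x);\tau(x)\rangle\,\mathrm{d}\mathcal{H}^k(x),\qquad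 T_S(\omega)=\frac{1}{\mathcal{H}^k(S)}\int_S\omega ,$$ and let $\mathscr{A}^k(E)$ be the set of all such functionals $T_S$. Let $\mathscr{V}(E)\subset\mathscr{C}^0(E,\Lambda^k)$ be a subspace of finite dimension $N$, let $\mathcal{T}=\{T_1,\dots,T_M\}\subset\mathscr{A}^k(E)$ be determining for $\mathscr{V}(E)$ (if $\omega\in\mathscr V(E)$ and $T_i(\omega)=0$ for all $i$, then $\omega=0$), and let $w_1,\dots,w_M>0$. Put $(\omega,\theta)_{\mathcal{T},w}=\sum_{i=1}^M w_iT_i(\omega)T_i(\theta)$ and $$\mathscr{M}(\mathcal{T},\mathscr{V}(E))=\sup_{T\in\mathscr{A}^k(E)}\sum_{i=1}^M\Big|\sum_{h=1}^N T_i(\eta_h)\,T(\eta_h)\Big|\,w_i ,$$ where $\{\eta_1,\dots,\eta_N\}$ is any basis of $\mathscr{V}(E)$ that is orthonormal for $(\cdot,\cdot)_{\mathcal{T},w}$. **Proposition.** Let $\widehat E\subset\mathbb{R}^n$ be compact (for instance the closure of a bounded Lipschitz domain), and let $\varphi$ be a $\mathscr{C}^1$ diffeomorphism from an open neighbourhood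 of $\widehat E$ onto an open subset of $\mathbb{R}^n$, with $\varphi(\widehat E)=E$. Let $\sigma_1(x)\ge\dots\ge\sigma_n(x)>0$ be the singular values of $D\varphi(x)$, and let $\|\cdot\|_\infty$ denote the supremum over $x\in\widehat E$. Let $\mathscr{V}(E)\subset\mathscr{C}^0(E,\Lambda^k)$ be a finite-dimensional subspace and let $\mathscr{V}(\widehat E)=\varphi^*\mathscr{V}(E)$. Let $\widehat{\mathcal{T}}=\{T_{S_1},\dots,T_{S_M}\}\subset\mathscr{A}^k(\widehat E)$ be determining for $\mathscr{V}(\widehat E)$, with weights $\widehat w_1,\dots,\widehat w_M>0$, and let $\mathcal{T}=\{T_{\varphi(S_1)},\dots,T_{\varphi(S_M)}\}$, where $\varphi(S_i)$ carries the orientation inherited from $S_i$ through $\varphi$ (the normalization of the image of the orienting $k$-vector under $D\varphi$), with the weights $$w_i=\Big(\frac{\mathcal{H}^k(\varphi(S_i))}{\mathcal{H}^k(S_i)}\Big)^2\,\widehat w_i,\qquad i=1,\dots,M .$$ Then $$\mathscr{M}(\mathcal{T},\mathscr{V}(E))\le\frac{\Big\|\prod_{j=1}^k\sigma_j\Big\|_\infty}{\Big(\Big\|\prod_{j=n-k+1}^n\sigma_j^{-1}\Big\|_\infty\Big)^{-1}}\;\mathscr{M}(\widehat{\mathcal{T}},\mathscr{V}(\widehat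 E)).$$ -/

import Mathlib

open MeasureTheory Set
open scoped ENNReal

noncomputable section

namespace LeastSquaresForms

/-- The Euclidean space `ℝⁿ`. -/
abbrev Space (n : ℕ) : Type := EuclideanSpace ℝ (Fin n)

/-- The space `Λ_k` of `k`-vectors of `ℝⁿ`, with its Euclidean inner product, for which the
`e_{α(1)} ∧ ⋯ ∧ e_{α(k)}` with `α` increasing form an orthonormal basis. -/
abbrev KVector (n k : ℕ) : Type := ⋀[ℝ]^k (Space n)

/-- The space `Λ^k = (Λ_k)*` of `k`-covectors of `ℝⁿ`. -/
abbrev KCovector (n k : ℕ) : Type := KVector n k →L[ℝ] ℝ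

/-- The space of continuous differential `k`-forms on `E ⊆ ℝⁿ`. -/
abbrev Form {n : ℕ} (k : ℕ) (E : Set (Space n)) : Type := C(E, KCovector n k)

/-! ### Submanifolds, rectifiable sets, orientations -/

/-- `T` is the tangent space at `x ∈ M` of the set `M`, and `M` is a `C¹` embedded submanifold
near `x`: a `C¹` diffeomorphism `Φ` between open sets, defined near `x`, flattens `M` onto a
linear subspace `L`, and `T = (DΦ(x))⁻¹ L`. -/
def IsTangentSpace {n : ℕ} (M : Set (Space n)) (x : Space n) (T : Submodule ℝ (Space n)) : Prop :=
  ∃ (Φ : OpenPartialHomeomorph (Space n) (Space n)) (L : Submodule ℝ (Space n)),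
    ContDiffOn ℝ 1 Φ Φ.source ∧ ContDiffOn ℝ 1 Φ.symm Φ.target ∧
    x ∈ M ∧ x ∈ Φ.source ∧
    Φ '' (M ∩ Φ.source) = (L : Set (Space n)) ∩ Φ.target ∧
    T = L.comap (fderiv ℝ Φ x : Space n →ₗ[ℝ] Space n)

/-- `M` is a `k`-dimensional embedded `C¹` submanifold of `ℝⁿ`. -/
def IsC1Submanifold {n : ℕ} (k : ℕ) (M : Set (Space n)) : Prop :=
  ∀ x ∈ M, ∃ T : Submodule ℝ (Space n), Module.finrank ℝ T = k ∧ IsTangentSpace M x T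

/-- `S` is `k`-rectifiable: up to an `ℋᵏ`-null set it is covered by countably many Lipschitz
images of `ℝᵏ`. Here `μHE[k]` is the `k`-dimensional Hausdorff measure, normalized so as to
agree with Lebesgue measure on `ℝᵏ`. -/
def IsRectifiable {n : ℕ} (k : ℕ) (S : Set (Space n)) : Prop :=
  ∃ f : ℕ → Space k → Space n, (∀ j, ∃ C, LipschitzWith C (f j)) ∧
    μHE[k] (S \ ⋃ j, range (f j)) = 0

/-- `ξ` is a Euclidean unit simple `k`-vector `c • v₁ ∧ ⋯ ∧ v_k` such that `v₁, …, v_k` is a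
basis of `T`. (The scalar `c` matters only for `k = 0`, where it gives the two orientations
`±1` of a point.) -/
def IsUnitSimple {n k : ℕ} (ξ : KVector n k) (T : Submodule ℝ (Space n)) : Prop :=
  ‖ξ‖ = 1 ∧ ∃ (c : ℝ) (v : Fin k → Space n), LinearIndependent ℝ v ∧
    Submodule.span ℝ (range v) = T ∧ ξ = c • exteriorPower.ιMulti ℝ k v

/-- `τ` is an orientation of `S`: up to an `ℋᵏ`-null set `S` is the disjoint union `S_reg` of
countably many measurable pieces `K j` of `k`-dimensional embedded `C¹` submanifolds `M j`,
the restriction of `τ` to `S_reg` is continuous, and `τ x` is a unit simple `k`-vector spanning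
the tangent space at every `x ∈ S_reg`. (The pieces may be taken Borel: null sets can be moved
to the singular part.) -/
def IsOrientation {n k : ℕ} (S : Set (Space n)) (τ : Space n → KVector n k) : Prop :=
  ∃ K M : ℕ → Set (Space n),
    (∀ j, MeasurableSet (K j)) ∧ (∀ i j, i ≠ j → Disjoint (K i) (K j)) ∧
    (∀ j, IsC1Submanifold k (M j)) ∧ (∀ j, K j ⊆ M j) ∧
    (⋃ j, K j) ⊆ S ∧ μHE[k] (S \ ⋃ j, K j) = 0 ∧
    ContinuousOn τ (⋃ j, K j) ∧
    ∀ j, ∀ x ∈ K j, ∃ T, IsTangentSpace (M j) x T ∧ IsUnitSimple (τ x) T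

/-- A set together with a field of `k`-vectors. -/
structure KSet (n k : ℕ) where
  /-- the underlying set -/
  carrier : Set (Space n)
  /-- the field of `k`-vectors -/
  orient : Space n → KVector n k

/-- The supports of the currents of integral averaging on `E`: the `ℋᵏ`-measurable
`k`-rectifiable oriented subsets of `E` of positive and finite `ℋᵏ`-measure. -/
structure KSet.IsOrientedRectifiable {n k : ℕ} (S : KSet n k) (E : Set (Space n)) : Prop where
  subset : S.carrier ⊆ E
  nullMeasurableSet : NullMeasurableSet S.carrier (μHE[k] : Measure (Space n))
  isRectifiable : IsRectifiable k S.carrier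
  pos : 0 < (μHE[k] : Measure (Space n)) S.carrier
  lt_top : (μHE[k] : Measure (Space n)) S.carrier < ∞
  isOrientation : IsOrientation S.carrier S.orient

/-! ### Currents of integral averaging, least squares -/

open Classical in
/-- The integral of a form on `E` over `S ⊆ E`, that is `∫_S ⟨ω(x); τ(x)⟩ dℋᵏ(x)`. -/
def integral {n k : ℕ} {E : Set (Space n)} (S : KSet n k) (ω : Form k E) : ℝ :=
  ∫ x in S.carrier, (if h : x ∈ E then ω ⟨x, h⟩ (S.orient x) else 0)
    ∂(μHE[k] : Measure (Space n))

/-- The real number `ℋᵏ(S)`. -/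
def vol {n k : ℕ} (S : KSet n k) : ℝ := ((μHE[k] : Measure (Space n)) S.carrier).toReal

/-- The current of integral averaging `T_S(ω) = ℋᵏ(S)⁻¹ ∫_S ω`. -/
def avg {n k : ℕ} {E : Set (Space n)} (S : KSet n k) (ω : Form k E) : ℝ :=
  (vol S)⁻¹ * integral S ω

/-- The averaging currents `T_{S₁}, …, T_{S_M}` are determining for the space of forms `V`. -/
def IsDetermining {n k M : ℕ} {E : Set (Space n)} (S : Fin M → KSet n k)
    (V : Submodule ℝ (Form k E)) : Prop :=
  ∀ ω ∈ V, (∀ i, avg (S i) ω = 0) → ω = 0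

/-- The bilinear form `(ω, θ)_{𝒯,w} = ∑ᵢ wᵢ Tᵢ(ω) Tᵢ(θ)`. -/
def scalarProduct {n k M : ℕ} {E : Set (Space n)} (S : Fin M → KSet n k) (w : Fin M → ℝ)
    (ω θ : Form k E) : ℝ :=
  ∑ i, w i * avg (S i) ω * avg (S i) θ

/-- `η` is an orthonormal basis of `V` with respect to `(·, ·)_{𝒯,w}`. -/
structure IsOrthonormalBasis {n k M N : ℕ} {E : Set (Space n)} (S : Fin M → KSet n k)
    (w : Fin M → ℝ) (V : Submodule ℝ (Form k E)) (η : Fin N → Form k E) : Prop where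
  linearIndependent : LinearIndependent ℝ η
  span_eq : Submodule.span ℝ (range η) = V
  orthonormal : ∀ h l, scalarProduct S w (η h) (η l) = if h = l then 1 else 0

/-- The least squares constant
`𝓜 = sup_T ∑ᵢ |∑ₕ Tᵢ(ηₕ) T(ηₕ)| wᵢ`, the supremum being over all currents `T` of integral
averaging on `E`, computed with the orthonormal basis `η`, as an element of `[0, ∞]`. -/
def lsqConstant {n k M N : ℕ} {E : Set (Space n)} (S : Fin M → KSet n k) (w : Fin M → ℝ)
    (η : Fin N → Form k E) : ℝ≥0∞ :=
  ⨆ (R : KSet n k) (_ : R.IsOrientedRectifiable E),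
    ENNReal.ofReal (∑ i, |∑ h, avg (S i) (η h) * avg R (η h)| * w i)

/-! ### Diffeomorphisms, pullback, transport of the data -/

/-- `φ` is a `C¹` diffeomorphism of `Ehat` onto `E`: it maps an open neighbourhood `φ.source` of
`Ehat` bijectively onto an open set, it is `C¹` with `C¹` inverse, and `φ(Ehat) = E`. -/
structure IsC1Diffeo {n : ℕ} (φ : OpenPartialHomeomorph (Space n) (Space n))
    (Ehat E : Set (Space n)) : Prop where
  contDiffOn : ContDiffOn ℝ 1 φ φ.source
  contDiffOn_symm : ContDiffOn ℝ 1 φ.symm φ.target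
  subset_source : Ehat ⊆ φ.source
  image_eq : φ '' Ehat = E

/-- The linear map `Λ_k A : Λ_k → Λ_k`, `v₁ ∧ ⋯ ∧ v_k ↦ A v₁ ∧ ⋯ ∧ A v_k`. -/
def extMap {n : ℕ} (k : ℕ) (A : Space n →L[ℝ] Space n) : KVector n k →L[ℝ] KVector n k :=
  LinearMap.toContinuousLinearMap (exteriorPower.map k (A : Space n →ₗ[ℝ] Space n))

theorem continuous_extMap {n : ℕ} (k : ℕ) : Continuous (extMap (n := n) k) := by
  refine continuous_clm_apply.2 fun ξ => ?_
  have hξ : ξ ∈ Submodule.span ℝ (range (exteriorPower.ιMulti ℝ k (M := Space n))) := by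
    rw [exteriorPower.ιMulti_span]; trivial
  induction hξ using Submodule.span_induction with
  | mem x hx =>
    obtain ⟨v, rfl⟩ := hx
    have h : Continuous fun u : Fin k → Space n => exteriorPower.ιMulti ℝ k u := by
      let b := EuclideanSpace.basisFun (Fin n) ℝ
      have hu : ∀ u : Fin k → Space n, exteriorPower.ιMulti ℝ k u =
          ∑ r : Fin k → Fin n, (∏ i, u i (r i)) • exteriorPower.ιMulti ℝ k fun i => b (r i) := by
        intro u
        have h0 : u = fun i => ∑ j, u i j • b j := by
          funext i
          simpa [b] using ((b.sum_repr (u i)).symm)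
        conv_lhs => rw [h0]
        rw [← AlternatingMap.coe_multilinearMap, MultilinearMap.map_sum]
        simp only [MultilinearMap.map_smul_univ]
      rw [funext hu]
      fun_prop
    have h2 : ∀ A : Space n →L[ℝ] Space n, extMap k A (exteriorPower.ιMulti ℝ k v)
        = exteriorPower.ιMulti ℝ k fun i => A (v i) := fun A => by
      simp [extMap, exteriorPower.map_apply_ιMulti, Function.comp_def]
    simp only [h2]
    exact h.comp (by fun_prop)
  | zero => simpa using continuous_const
  | add x y _ _ hx hy => simpa only [map_add] using hx.fun_add hy
  | smul c x _ hx => simpa only [map_smul] using hx.fun_const_smul c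

theorem IsC1Diffeo.mem {n : ℕ} {φ : OpenPartialHomeomorph (Space n) (Space n)}
    {Ehat E : Set (Space n)} (hφ : IsC1Diffeo φ Ehat E) (x : Ehat) : φ x ∈ E :=
  hφ.image_eq ▸ mem_image_of_mem φ x.2

/-- The pullback `(φ^* ω)(x) = ω(φ(x)) ∘ Λ_k Dφ(x)` of forms on `E` to forms on `Ehat`. -/
def pullback {n : ℕ} (k : ℕ) {φ : OpenPartialHomeomorph (Space n) (Space n)}
    {Ehat E : Set (Space n)} (hφ : IsC1Diffeo φ Ehat E) : Form k E →ₗ[ℝ] Form k Ehat where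
  toFun ω :=
    { toFun := fun x => (ω ⟨φ x, hφ.mem x⟩).comp (extMap k (fderiv ℝ φ x))
      continuous_toFun := by
        have h1 : Continuous fun x : Ehat => (⟨φ x, hφ.mem x⟩ : E) :=
          ((φ.continuousOn.mono hφ.subset_source).comp_continuous continuous_subtype_val
            fun x => x.2).subtype_mk _
        have h2 : Continuous fun x : Ehat => fderiv ℝ φ x :=
          ((hφ.contDiffOn.continuousOn_fderiv_of_isOpen φ.open_source le_rfl).mono
            hφ.subset_source).comp_continuous continuous_subtype_val fun x => x.2
        exact (ω.continuous.comp h1).clm_comp ((continuous_extMap k).comp h2) }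
  map_add' ω θ := by ext x : 1; simp [ContinuousLinearMap.add_comp]
  map_smul' c ω := by ext x : 1; simp [ContinuousLinearMap.smul_comp]

/-- The image `φ(S)` with the orientation inherited from `S` through `φ`: the `k`-vector at
`φ(x)` is `Λ_k Dφ(x) τ(x)`, normalized. -/
def KSet.push {n k : ℕ} (φ : OpenPartialHomeomorph (Space n) (Space n)) (S : KSet n k) :
    KSet n k where
  carrier := φ '' S.carrier
  orient := fun y =>
    ‖extMap k (fderiv ℝ φ (φ.symm y)) (S.orient (φ.symm y))‖⁻¹ •
      extMap k (fderiv ℝ φ (φ.symm y)) (S.orient (φ.symm y))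

/-- The weight `(ℋᵏ(φ(S)) / ℋᵏ(S))² w`. -/
def pushWeight {n k : ℕ} (φ : OpenPartialHomeomorph (Space n) (Space n)) (S : KSet n k)
    (w : ℝ) : ℝ :=
  (vol (S.push φ) / vol S) ^ 2 * w

/-- The singular values `σ_0 ≥ σ_1 ≥ ⋯ ≥ σ_{n-1}` of `Dφ(x)` (numbered from `0`). -/
def sigma {n : ℕ} (φ : OpenPartialHomeomorph (Space n) (Space n)) (x : Space n) (j : ℕ) : ℝ :=
  (fderiv ℝ φ x : Space n →ₗ[ℝ] Space n).singularValues j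

/-- The supremum over `Ehat` of the product of the `k` largest singular values of `Dφ`. -/
def supLargest {n : ℕ} (k : ℕ) (φ : OpenPartialHomeomorph (Space n) (Space n))
    (Ehat : Set (Space n)) : ℝ≥0∞ :=
  ⨆ x ∈ Ehat, ENNReal.ofReal (∏ j ∈ Finset.range k, sigma φ x j)

/-- The supremum over `Ehat` of the product of the inverses of the `k` smallest singular values
of `Dφ`. -/
def supInvSmallest {n : ℕ} (k : ℕ) (φ : OpenPartialHomeomorph (Space n) (Space n))
    (Ehat : Set (Space n)) : ℝ≥0∞ :=
  ⨆ x ∈ Ehat, ENNReal.ofReal (∏ j ∈ Finset.Ico (n - k) n, (sigma φ x j)⁻¹)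

end LeastSquaresForms

end

namespace LeastSquaresForms

open Module Filter Topology Asymptotics
open scoped NNReal

/-! For a unit simple `k`-vector `τ(x)` spanning the tangent space, `‖Λ_k Dφ(x) τ(x)‖` is the
Jacobian of `φ` along `S`. The area formula makes it cancel the normalization of the transported
orientation, so `∫_{φ(S)} ω = ∫_S φ^*ω`, and `T_{φ(S)}(ω)` is `T_S(φ^*ω)` times `ℋᵏ(S)/ℋᵏ(φ(S))`
(`integral_push`, `avg_push`).

The weights carry the inverse square of this ratio, so `φ^*` preserves the scalar products and pulls
an orthonormal basis back to an orthonormal basis (`scalarProduct_push`). The kernel `∑ₕ a(ηₕ)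
b(ηₕ)` does not depend on the orthonormal basis (`sum_mul_eq_of_orthonormal`). Hence, for a
competitor `R` in `E`, the `i`-th term of the constant is the term of `R' = φ⁻¹(R)` times
`ℋᵏ(φ(Sᵢ))/ℋᵏ(Sᵢ)` and `ℋᵏ(R')/ℋᵏ(R)`. Since the Jacobian lies between the products of the `k`
smallest and the `k` largest singular values, the suprema in the statement bound these two ratios.

The area formula is obtained by linearization: near a point of a `C¹` piece, `φ` is comparable, up
to a factor `C > 1`, to `Dφ` after projection onto the tangent space. The linear case is exact; a
countable cover and `C → 1` conclude. -/

theorem extMap_ιMulti {n k : ℕ} (A : Space n →L[ℝ] Space n) (v : Fin k → Space n) :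
    extMap k A (exteriorPower.ιMulti ℝ k v) = exteriorPower.ιMulti ℝ k fun i => A (v i) := by
  simp [extMap, exteriorPower.map_apply_ιMulti, Function.comp_def]

theorem extMap_comp {n k : ℕ} (A B : Space n →L[ℝ] Space n) (ξ : KVector n k) :
    extMap k (A.comp B) ξ = extMap k A (extMap k B ξ) := by
  simp only [extMap, LinearMap.coe_toContinuousLinearMap', ContinuousLinearMap.toLinearMap_comp]
  rw [exteriorPower.map_comp]
  rfl

theorem extMap_id {n k : ℕ} (ξ : KVector n k) :
    extMap k (ContinuousLinearMap.id ℝ (Space n)) ξ = ξ := by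
  simp [extMap]

/-! ### The Euclidean norm of the image of a `k`-vector -/

/-- Moving `A` across the inner product by its adjoint multiplies each Gram entry by the eigenvalue
of its `s`-index, and these factors leave the determinant. Thus the wedge basis diagonalizes `(Λ_k
A)^* Λ_k A`. -/
theorem inner_extMap_ιMulti_family {n k : ℕ} (A : Space n →L[ℝ] Space n)
    (b : OrthonormalBasis (Fin n) ℝ (Space n)) (μ : Fin n → ℝ)
    (hb : ∀ i, LinearMap.adjoint (A : Space n →ₗ[ℝ] Space n) (A (b i)) = μ i • b i)
    (s t : powersetCard (Fin n) k) :
    inner ℝ (extMap k A (b.exteriorPower k s)) (extMap k A (b.exteriorPower k t)) =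
      (∏ i, μ (powersetCard.ofFinEmbEquiv.symm s i)) * if s = t then 1 else 0 := by
  have hB : ∀ s, b.exteriorPower k s =
      exteriorPower.ιMulti ℝ k fun i => b (powersetCard.ofFinEmbEquiv.symm s i) := fun s => by
    rw [← OrthonormalBasis.coe_toBasis, OrthonormalBasis.toBasis_exteriorPower,
      exteriorPower.basis_apply]
    simp [exteriorPower.ιMulti_family, Function.comp_def]
  rw [← orthonormal_iff_ite.1 (b.exteriorPower k).orthonormal s t, hB, hB, extMap_ιMulti,
    extMap_ιMulti, exteriorPower.inner_ιMulti_ιMulti, exteriorPower.inner_ιMulti_ιMulti,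
    ← Matrix.det_mul_row]
  congr 1
  ext i j
  have := LinearMap.adjoint_inner_left (A : Space n →ₗ[ℝ] Space n)
    (b (powersetCard.ofFinEmbEquiv.symm t i)) (A (b (powersetCard.ofFinEmbEquiv.symm s j)))
  rw [hb, inner_smul_left] at this
  simpa using this.symm

theorem norm_sq_extMap {n k : ℕ} (A : Space n →L[ℝ] Space n)
    (b : OrthonormalBasis (Fin n) ℝ (Space n)) (μ : Fin n → ℝ)
    (hb : ∀ i, LinearMap.adjoint (A : Space n →ₗ[ℝ] Space n) (A (b i)) = μ i • b i)
    (ξ : KVector n k) :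
    ‖extMap k A ξ‖ ^ 2 = ∑ s, (∏ i, μ (powersetCard.ofFinEmbEquiv.symm s i)) *
      ((b.exteriorPower k).repr ξ s) ^ 2 := by
  conv_lhs => rw [← (b.exteriorPower k).sum_repr ξ, map_sum]
  rw [← real_inner_self_eq_norm_sq, sum_inner]
  refine Finset.sum_congr rfl fun s _ => ?_
  rw [inner_sum]
  have key : ∀ (a c : ℝ) (x y : KVector n k),
      inner ℝ (a • x) (c • y) = a * (c * inner ℝ x y) := fun a c x y =>
    (real_inner_smul_left x (c • y) a).trans (congrArg _ (real_inner_smul_right x y c))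
  simp only [map_smul, key, inner_extMap_ιMulti_family A b μ hb, mul_ite, mul_one, mul_zero,
    Finset.sum_ite_eq, Finset.mem_univ, if_true]
  ring

theorem norm_sq_eq_sum_repr {n k : ℕ} (b : OrthonormalBasis (Fin n) ℝ (Space n))
    (ξ : KVector n k) : ‖ξ‖ ^ 2 = ∑ s, ((b.exteriorPower k).repr ξ s) ^ 2 := by
  rw [← (b.exteriorPower k).repr.norm_map, EuclideanSpace.norm_sq_eq]
  simp

/-- A strictly increasing integer sequence grows by at least one per step. This yields `i ≤ f i ≤ n
- k + i`, which compares any product of `k` singular values with the extreme ones. -/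
theorem orderEmbedding_sub_le {n k : ℕ} (f : Fin k ↪o Fin n) (i j : Fin k) (hij : i ≤ j) :
    (j : ℕ) - i ≤ (f j : ℕ) - f i := by
  obtain ⟨i, hi⟩ := i
  obtain ⟨j, hj⟩ := j
  simp only [Fin.mk_le_mk] at hij
  induction j, hij using Nat.le_induction with
  | base => simp
  | succ j hij ih =>
    have h1 := ih (by omega)
    have h2 : f ⟨j, by omega⟩ < f ⟨j + 1, hj⟩ := f.strictMono (by simp)
    have h3 : f ⟨i, hi⟩ ≤ f ⟨j, by omega⟩ := f.monotone (by simpa using hij)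
    simp only [Fin.lt_def, Fin.le_def] at *
    omega

theorem le_orderEmbedding {n k : ℕ} (f : Fin k ↪o Fin n) (i : Fin k) : (i : ℕ) ≤ f i := by
  have := orderEmbedding_sub_le f ⟨0, i.pos⟩ i (by simp [Fin.le_def])
  simp only [Nat.sub_zero] at this
  omega

theorem orderEmbedding_le {n k : ℕ} (f : Fin k ↪o Fin n) (i : Fin k) :
    (f i : ℕ) ≤ n - k + i := by
  have hk := i.pos
  have := orderEmbedding_sub_le f i ⟨k - 1, by omega⟩ (by simp only [Fin.le_def]; omega)
  have h2 := (f ⟨k - 1, by omega⟩).isLt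
  have h3 := (f i).isLt
  have h4 := i.isLt
  have h5 : f i ≤ f ⟨k - 1, by omega⟩ := f.monotone (by simp only [Fin.le_def]; omega)
  simp only [Fin.le_def] at *
  omega

theorem exists_singular_basis {n : ℕ} (A : Space n →L[ℝ] Space n) :
    ∃ b : OrthonormalBasis (Fin n) ℝ (Space n), ∀ i,
      LinearMap.adjoint (A : Space n →ₗ[ℝ] Space n) (A (b i)) =
        ((A : Space n →ₗ[ℝ] Space n).singularValues i) ^ 2 • b i := by
  have hn : finrank ℝ (Space n) = n := by simp
  refine ⟨(A : Space n →ₗ[ℝ] Space n).isSymmetric_adjoint_comp_self.eigenvectorBasis hn,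
    fun i => ?_⟩
  rw [LinearMap.sq_singularValues_fin _ hn]
  exact (A : Space n →ₗ[ℝ] Space n).isSymmetric_adjoint_comp_self.apply_eigenvectorBasis hn i

/-- In the wedge basis of singular vectors, `‖Λ_k A ξ‖²` weights each squared coordinate by `k`
squared singular values; the `i`-th chosen index is at least `i` and singular values decrease. -/
theorem norm_extMap_le {n k : ℕ} (A : Space n →L[ℝ] Space n) (ξ : KVector n k) :
    ‖extMap k A ξ‖ ≤
      (∏ j ∈ Finset.range k, (A : Space n →ₗ[ℝ] Space n).singularValues j) * ‖ξ‖ := by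
  obtain ⟨b, hb⟩ := exists_singular_basis A
  set σ := (A : Space n →ₗ[ℝ] Space n).singularValues
  have hσ : ∀ i, 0 ≤ σ i := LinearMap.singularValues_nonneg _
  refine le_of_sq_le_sq ?_ (mul_nonneg (Finset.prod_nonneg fun i _ => hσ i) (norm_nonneg _))
  rw [norm_sq_extMap A b _ hb, mul_pow, norm_sq_eq_sum_repr b, Finset.mul_sum]
  refine Finset.sum_le_sum fun s _ => mul_le_mul_of_nonneg_right ?_ (sq_nonneg _)
  rw [← Fin.prod_univ_eq_prod_range, ← Finset.prod_pow]
  refine Finset.prod_le_prod (fun i _ => sq_nonneg _) fun i _ => ?_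
  exact pow_le_pow_left₀ (hσ _) (LinearMap.singularValues_antitone _ (le_orderEmbedding _ i)) 2

theorem le_norm_extMap {n k : ℕ} (hk : k ≤ n) (A : Space n →L[ℝ] Space n) (ξ : KVector n k) :
    (∏ j ∈ Finset.Ico (n - k) n, (A : Space n →ₗ[ℝ] Space n).singularValues j) * ‖ξ‖ ≤
      ‖extMap k A ξ‖ := by
  obtain ⟨b, hb⟩ := exists_singular_basis A
  set σ := (A : Space n →ₗ[ℝ] Space n).singularValues
  have hσ : ∀ i, 0 ≤ σ i := LinearMap.singularValues_nonneg _
  refine le_of_sq_le_sq ?_ (norm_nonneg _)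
  rw [norm_sq_extMap A b _ hb, mul_pow, norm_sq_eq_sum_repr b, Finset.mul_sum]
  refine Finset.sum_le_sum fun s _ => mul_le_mul_of_nonneg_right ?_ (sq_nonneg _)
  rw [Finset.prod_Ico_eq_prod_range, Nat.sub_sub_self hk, ← Fin.prod_univ_eq_prod_range
    (fun i => σ (n - k + i)), ← Finset.prod_pow]
  refine Finset.prod_le_prod (fun i _ => sq_nonneg _) fun i _ => ?_
  exact pow_le_pow_left₀ (hσ _) (LinearMap.singularValues_antitone _ (orderEmbedding_le _ i)) 2

theorem IsUnitSimple.finrank_eq {n k : ℕ} {ξ : KVector n k} {T : Submodule ℝ (Space n)}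
    (h : IsUnitSimple ξ T) : finrank ℝ T = k := by
  obtain ⟨-, c, v, hv, rfl, -⟩ := h
  simpa using finrank_span_eq_card hv

/-- This identifies the Jacobian. The frame `v` is a linear map `u : ℝᵏ → T`; Gram determinants are
squares of `normDet`, which is multiplicative under composition, and `‖ξ‖ = 1` says `c² (normDet u)²
= 1`. -/
theorem IsUnitSimple.norm_extMap {n k : ℕ} {ξ : KVector n k} {T : Submodule ℝ (Space n)}
    (h : IsUnitSimple ξ T) (A : Space n →L[ℝ] Space n) :
    ‖extMap k A ξ‖ = ((A : Space n →ₗ[ℝ] Space n).domRestrict T).normDet := by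
  have hT := h.finrank_eq
  obtain ⟨h1, c, v, hv, hspan, rfl⟩ := h
  have hvT : ∀ i, v i ∈ T := fun i => hspan ▸ Submodule.subset_span (mem_range_self i)
  let b := EuclideanSpace.basisFun (Fin k) ℝ
  let u : Space k →ₗ[ℝ] T := b.toBasis.constr ℝ fun i => ⟨v i, hvT i⟩
  have hu : ∀ i, u (b i) = ⟨v i, hvT i⟩ := fun i => by
    rw [← OrthonormalBasis.coe_toBasis]
    exact b.toBasis.constr_basis ℝ _ i
  have hnorm : ∀ w : Fin k → Space n,
      ‖c • exteriorPower.ιMulti ℝ k w‖ ^ 2 = c ^ 2 * (Matrix.gram ℝ w).det := fun w => by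
    rw [norm_smul, mul_pow, ← real_inner_self_eq_norm_sq (exteriorPower.ιMulti ℝ k w),
      exteriorPower.inner_ιMulti_self]
    simp
  have hcomp := LinearMap.normDet_comp_of_finrank_eq u
    ((A : Space n →ₗ[ℝ] Space n).domRestrict T) (by simp [hT])
  have e1 := LinearMap.normDet_sq_eq_det_gram u b
  have e2 := LinearMap.normDet_sq_eq_det_gram
    (((A : Space n →ₗ[ℝ] Space n).domRestrict T) ∘ₗ u) b
  have g1 : Matrix.gram ℝ (fun i => u (b i)) = Matrix.gram ℝ v := by
    ext i j; simp [hu, Matrix.gram]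
  have g2 : Matrix.gram ℝ (fun i => (((A : Space n →ₗ[ℝ] Space n).domRestrict T) ∘ₗ u) (b i)) =
      Matrix.gram ℝ fun i => A (v i) := by
    ext i j; simp [hu, Matrix.gram]
  simp only [RCLike.ofReal_real_eq_id, id] at e1 e2
  rw [g1] at e1
  rw [g2, hcomp, mul_pow, e1] at e2
  have h2 := hnorm v
  rw [h1] at h2
  refine (sq_eq_sq₀ (norm_nonneg _) (LinearMap.normDet_nonneg _)).1 ?_
  rw [map_smul, extMap_ιMulti, hnorm, ← e2]
  linear_combination -(LinearMap.normDet ((A : Space n →ₗ[ℝ] Space n).domRestrict T)) ^ 2 * h2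

/-! ### Hausdorff measures and Lipschitz maps -/

theorem euclideanHausdorffMeasure_image_le_of_lipschitzOnWith {X Y : Type*} [MetricSpace X]
    [MeasurableSpace X] [BorelSpace X] [MetricSpace Y] [MeasurableSpace Y] [BorelSpace Y]
    {K : ℝ≥0} {f : X → Y} {s : Set X} (h : LipschitzOnWith K f s) (d : ℕ) :
    (μHE[d] : Measure Y) (f '' s) ≤ (K : ℝ≥0∞) ^ d * (μHE[d] : Measure X) s := by
  simp_rw [Measure.euclideanHausdorffMeasure_def, Measure.smul_apply, ENNReal.smul_def, smul_eq_mul]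
  rw [mul_left_comm]
  gcongr
  simpa using h.hausdorffMeasure_image_le (Nat.cast_nonneg d)

/-- The hypothesis makes `g` factor through `f` on `s`, even for non-injective `f`, and the factor
is `K`-Lipschitz on `f '' s`. -/
theorem euclideanHausdorffMeasure_image_le_image {X Y Z : Type*} [MetricSpace Y]
    [MeasurableSpace Y] [BorelSpace Y] [MetricSpace Z] [MeasurableSpace Z] [BorelSpace Z]
    {K : ℝ≥0} {f : X → Y} {g : X → Z} {s : Set X}
    (h : ∀ x ∈ s, ∀ y ∈ s, dist (g x) (g y) ≤ K * dist (f x) (f y)) (d : ℕ) :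
    (μHE[d] : Measure Z) (g '' s) ≤ (K : ℝ≥0∞) ^ d * (μHE[d] : Measure Y) (f '' s) := by
  rcases s.eq_empty_or_nonempty with rfl | ⟨x₀, -⟩
  · simp
  have : Nonempty X := ⟨x₀⟩
  have hinv : ∀ x ∈ s, g (Function.invFunOn f s (f x)) = g x := fun x hx => by
    have h1 : ∃ a ∈ s, f a = f x := ⟨x, hx, rfl⟩
    have h2 := h _ (Function.invFunOn_mem h1) _ hx
    rw [Function.invFunOn_eq h1, dist_self, mul_zero] at h2
    exact dist_le_zero.1 h2
  have himg : g '' s = (fun y => g (Function.invFunOn f s y)) '' (f '' s) := by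
    rw [image_image]
    exact image_congr fun x hx => (hinv x hx).symm
  rw [himg]
  refine euclideanHausdorffMeasure_image_le_of_lipschitzOnWith
    (LipschitzOnWith.of_dist_le_mul ?_) d
  rintro _ ⟨x, hx, rfl⟩ _ ⟨y, hy, rfl⟩
  simpa only [hinv x hx, hinv y hy] using h x hx y hy

/-! ### `C¹` diffeomorphisms between open sets -/

section Diffeo

variable {n : ℕ} {φ : OpenPartialHomeomorph (Space n) (Space n)}

theorem hasStrictFDerivAt_of_contDiffOn (h : ContDiffOn ℝ 1 φ φ.source) {x : Space n}
    (hx : x ∈ φ.source) : HasStrictFDerivAt φ (fderiv ℝ φ x) x :=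
  (h.contDiffAt (φ.open_source.mem_nhds hx)).hasStrictFDerivAt one_ne_zero

theorem fderiv_symm_comp_fderiv (h : ContDiffOn ℝ 1 φ φ.source)
    (h' : ContDiffOn ℝ 1 φ.symm φ.target) {x : Space n} (hx : x ∈ φ.source) :
    (fderiv ℝ φ.symm (φ x)).comp (fderiv ℝ φ x) = ContinuousLinearMap.id ℝ (Space n) := by
  have h1 := (hasStrictFDerivAt_of_contDiffOn h hx).hasFDerivAt
  have h2 := (hasStrictFDerivAt_of_contDiffOn (φ := φ.symm) h' (φ.map_source hx)).hasFDerivAt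
  refine (h2.comp x h1).unique ((hasFDerivAt_id x).congr_of_eventuallyEq ?_)
  filter_upwards [φ.open_source.mem_nhds hx] with y hy using φ.left_inv hy

theorem fderiv_symm_apply_fderiv (h : ContDiffOn ℝ 1 φ φ.source)
    (h' : ContDiffOn ℝ 1 φ.symm φ.target) {x : Space n} (hx : x ∈ φ.source) (v : Space n) :
    fderiv ℝ φ.symm (φ x) (fderiv ℝ φ x v) = v :=
  DFunLike.congr_fun (fderiv_symm_comp_fderiv h h' hx) v

theorem fderiv_apply_fderiv_symm (h : ContDiffOn ℝ 1 φ φ.source)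
    (h' : ContDiffOn ℝ 1 φ.symm φ.target) {x : Space n} (hx : x ∈ φ.source) (v : Space n) :
    fderiv ℝ φ x (fderiv ℝ φ.symm (φ x) v) = v := by
  have := fderiv_symm_apply_fderiv (φ := φ.symm) h' h (φ.map_source hx) v
  rwa [OpenPartialHomeomorph.symm_symm, φ.left_inv hx] at this

theorem injective_fderiv (h : ContDiffOn ℝ 1 φ φ.source)
    (h' : ContDiffOn ℝ 1 φ.symm φ.target) {x : Space n} (hx : x ∈ φ.source) :
    Function.Injective (fderiv ℝ φ x) :=
  Function.LeftInverse.injective (fderiv_symm_apply_fderiv h h' hx)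

end Diffeo

/-! ### Tangent spaces and linear approximation on a submanifold -/

/-- Short chords of `M` are almost tangent: the flattening chart sends them into `L`, hence `D'` of
their images lies in `T`. -/
theorem IsTangentSpace.sub_isEquivalent {n : ℕ} {M : Set (Space n)} {x₀ : Space n}
    {T : Submodule ℝ (Space n)} (hT : IsTangentSpace M x₀ T) :
    (fun p : Space n × Space n => T.starProjection (p.1 - p.2))
      ~[𝓝 (x₀, x₀) ⊓ 𝓟 (M ×ˢ M)] fun p => p.1 - p.2 := by
  obtain ⟨Φ, L, h1, h2, -, hx, him, rfl⟩ := hT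
  set D := fderiv ℝ Φ x₀
  set D' := fderiv ℝ Φ.symm (Φ x₀)
  set T := L.comap (D : Space n →ₗ[ℝ] Space n)
  have hD' : ∀ v, D' (D v) = v := fderiv_symm_apply_fderiv h1 h2 hx
  have hD : ∀ v, D (D' v) = v := fderiv_apply_fderiv_symm h1 h2 hx
  have s1 : (fun p : Space n × Space n => Φ p.1 - Φ p.2 - D (p.1 - p.2))
      =o[𝓝 (x₀, x₀) ⊓ 𝓟 (M ×ˢ M)] fun p => p.1 - p.2 :=
    (hasStrictFDerivAt_of_contDiffOn h1 hx).isLittleO.mono inf_le_left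
  -- This operator kills `Φ p.1 - Φ p.2`, so applied to the linearization error it leaves exactly
  -- the deviation of the chord from its projection.
  have s2 := ((ContinuousLinearMap.id ℝ (Space n) - T.starProjection).comp D').isBigO_comp
    (fun p : Space n × Space n => Φ p.1 - Φ p.2 - D (p.1 - p.2)) (𝓝 (x₀, x₀) ⊓ 𝓟 (M ×ˢ M))
  refine (s2.trans_isLittleO s1).congr' ?_ EventuallyEq.rfl
  have hmem : ∀ᶠ p in 𝓝 (x₀, x₀) ⊓ 𝓟 (M ×ˢ M), p ∈ Φ.source ×ˢ Φ.source :=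
    Filter.Eventually.filter_mono inf_le_left
      ((Φ.open_source.prod Φ.open_source).mem_nhds ⟨hx, hx⟩)
  have hM : ∀ᶠ p in 𝓝 (x₀, x₀) ⊓ 𝓟 (M ×ˢ M), p ∈ M ×ˢ M :=
    Filter.Eventually.filter_mono inf_le_right (mem_principal_self _)
  filter_upwards [hmem, hM] with p hp hpM
  have hL : ∀ y ∈ M, y ∈ Φ.source → Φ y ∈ L := fun y hy hy' =>
    (him.subset (mem_image_of_mem Φ ⟨hy, hy'⟩)).1
  have hT : D' (Φ p.1 - Φ p.2) ∈ T := by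
    change D (D' _) ∈ L
    rw [hD]
    exact L.sub_mem (hL _ hpM.1 hp.1) (hL _ hpM.2 hp.2)
  have h3 := Submodule.starProjection_eq_self_iff.2 hT
  simp only [ContinuousLinearMap.comp_apply, map_sub D' _ (D _), hD', Pi.sub_apply]
  rw [map_sub (ContinuousLinearMap.id ℝ (Space n) - T.starProjection)]
  simp only [_root_.sub_apply, h3]
  simp

/-- An injective `A` is antilipschitz, so errors that are small relative to the chord remain small
relative to `A` of its projection. -/
theorem IsTangentSpace.map_sub_isEquivalent {n : ℕ} {M : Set (Space n)} {x₀ : Space n}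
    {T : Submodule ℝ (Space n)} (hT : IsTangentSpace M x₀ T) {F : Space n → Space n}
    {A : Space n →L[ℝ] Space n} (hF : HasStrictFDerivAt F A x₀) (hA : Function.Injective A) :
    (fun p : Space n × Space n => F p.1 - F p.2)
      ~[𝓝 (x₀, x₀) ⊓ 𝓟 (M ×ˢ M)] fun p => A (T.starProjection (p.1 - p.2)) := by
  have h0 := hT.sub_isEquivalent
  have h1 : (fun p : Space n × Space n => F p.1 - F p.2 - A (p.1 - p.2))
      =o[𝓝 (x₀, x₀) ⊓ 𝓟 (M ×ˢ M)] fun p => p.1 - p.2 := hF.isLittleO.mono inf_le_left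
  have h2 : (fun p : Space n × Space n => A (T.starProjection (p.1 - p.2) - (p.1 - p.2)))
      =o[𝓝 (x₀, x₀) ⊓ 𝓟 (M ×ˢ M)] fun p => p.1 - p.2 :=
    (A.isBigO_comp _ _).trans_isLittleO h0
  obtain ⟨K, -, hK⟩ := (LinearMap.injective_iff_antilipschitz (A : Space n →ₗ[ℝ] Space n)).1 hA
  have h3 : (fun p : Space n × Space n => p.1 - p.2)
      =O[𝓝 (x₀, x₀) ⊓ 𝓟 (M ×ˢ M)] fun p => A (T.starProjection (p.1 - p.2)) := by
    refine h0.symm.isBigO.trans ?_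
    refine IsBigO.of_bound K (Eventually.of_forall fun p => ?_)
    exact hK.le_mul_norm (map_zero _) _
  refine ((h1.sub h2).trans_isBigO h3).congr_left fun p => ?_
  simp only [Pi.sub_apply, map_sub]
  abel

theorem eventually_norm_le_of_isEquivalent {α E : Type*} [NormedAddCommGroup E] {l : Filter α}
    {f g : α → E} (h : f ~[l] g) {C : ℝ} (hC : 1 < C) : ∀ᶠ p in l, ‖f p‖ ≤ C * ‖g p‖ := by
  filter_upwards [h.isLittleO.bound (sub_pos.2 hC)] with p hp
  calc ‖f p‖ = ‖(f p - g p) + g p‖ := by simp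
    _ ≤ ‖f p - g p‖ + ‖g p‖ := norm_add_le _ _
    _ ≤ (C - 1) * ‖g p‖ + ‖g p‖ := by gcongr; exact hp
    _ = C * ‖g p‖ := by ring

theorem exists_nhds_of_eventually_inf_principal {X : Type*} [TopologicalSpace X] {M : Set X}
    {x₀ : X} {P : X × X → Prop} (h : ∀ᶠ p in 𝓝 (x₀, x₀) ⊓ 𝓟 (M ×ˢ M), P p) :
    ∃ U ∈ 𝓝 x₀, ∀ x ∈ M ∩ U, ∀ y ∈ M ∩ U, P (x, y) := by
  rw [eventually_inf_principal, nhds_prod_eq] at h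
  obtain ⟨U, hU, h⟩ := eventually_prod_self_iff'.1 h
  exact ⟨U, hU, fun x hx y hy => h x hx.2 y hy.2 ⟨hx.1, hy.1⟩⟩

/-- On a small patch, `F` is compared with `A|_T` after projection onto `T`, where the linear
formula is exact. The lower bound pays `C ^ k` twice: for undoing the projection and for replacing
`F`. -/
theorem IsTangentSpace.exists_nhds_measure_image_le {n k : ℕ} {M : Set (Space n)} {x₀ : Space n}
    {T : Submodule ℝ (Space n)} (hT : IsTangentSpace M x₀ T) (hk : finrank ℝ T = k)
    {F : Space n → Space n} {A : Space n →L[ℝ] Space n} (hF : HasStrictFDerivAt F A x₀)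
    (hA : Function.Injective A) {C : ℝ≥0} (hC : 1 < C) :
    ∃ U ∈ 𝓝 x₀, ∀ s ⊆ M ∩ U,
      (μHE[k] : Measure (Space n)) (F '' s) ≤ (C : ℝ≥0∞) ^ k *
        (ENNReal.ofReal ((A : Space n →ₗ[ℝ] Space n).domRestrict T).normDet *
          (μHE[k] : Measure (Space n)) s) ∧
      ENNReal.ofReal ((A : Space n →ₗ[ℝ] Space n).domRestrict T).normDet *
        (μHE[k] : Measure (Space n)) s ≤
          (C : ℝ≥0∞) ^ (2 * k) * (μHE[k] : Measure (Space n)) (F '' s) := by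
  have hC' : (1 : ℝ) < C := by exact_mod_cast hC
  have e1 := eventually_norm_le_of_isEquivalent hT.sub_isEquivalent.symm hC'
  have e2 := eventually_norm_le_of_isEquivalent (hT.map_sub_isEquivalent hF hA) hC'
  have e3 := eventually_norm_le_of_isEquivalent (hT.map_sub_isEquivalent hF hA).symm hC'
  obtain ⟨U, hU, h⟩ := exists_nhds_of_eventually_inf_principal (e1.and (e2.and e3))
  refine ⟨U, hU, fun s hs => ?_⟩
  set L := (A : Space n →ₗ[ℝ] Space n).domRestrict T
  set p : Space n → T := fun x => T.orthogonalProjectionOnto x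
  have hp : ∀ x y, T.starProjection (x - y) = ((p x - p y : T) : Space n) := fun x y => by
    rw [map_sub]; rfl
  have hL : (μHE[k] : Measure (Space n)) ((fun x => L (p x)) '' s) =
      ENNReal.ofReal L.normDet * (μHE[k] : Measure T) (p '' s) := by
    subst hk
    rw [← LinearMap.euclideanHausdorffMeasure_image, image_image]
  have hLd : ∀ x y, A (T.starProjection (x - y)) = L (p x) - L (p y) := fun x y => by
    rw [hp]; exact map_sub L _ _
  have m1 : (μHE[k] : Measure T) (p '' s) ≤ (μHE[k] : Measure (Space n)) s := by
    have := euclideanHausdorffMeasure_image_le_image (K := 1) (f := id) (g := p) (s := s)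
      (fun x _ y _ => ?_) k
    · simpa using this
    · rw [dist_eq_norm, dist_eq_norm, ← map_sub]
      simpa using T.norm_orthogonalProjectionOnto_apply_le (x - y)
  have m2 : (μHE[k] : Measure (Space n)) s ≤ (C : ℝ≥0∞) ^ k * (μHE[k] : Measure T) (p '' s) := by
    have := euclideanHausdorffMeasure_image_le_image (K := C) (f := p) (g := id) (s := s)
      (fun x hx y hy => ?_) k
    · simpa using this
    · rw [dist_eq_norm, dist_eq_norm]
      simpa [hp] using (h x (hs hx) y (hs hy)).1
  have m3 : (μHE[k] : Measure (Space n)) (F '' s) ≤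
      (C : ℝ≥0∞) ^ k * (μHE[k] : Measure (Space n)) ((fun x => L (p x)) '' s) := by
    refine euclideanHausdorffMeasure_image_le_image (fun x hx y hy => ?_) k
    rw [dist_eq_norm, dist_eq_norm, ← hLd]
    exact (h x (hs hx) y (hs hy)).2.1
  have m4 : (μHE[k] : Measure (Space n)) ((fun x => L (p x)) '' s) ≤
      (C : ℝ≥0∞) ^ k * (μHE[k] : Measure (Space n)) (F '' s) := by
    refine euclideanHausdorffMeasure_image_le_image (fun x hx y hy => ?_) k
    rw [dist_eq_norm, dist_eq_norm, ← hLd]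
    exact (h x (hs hx) y (hs hy)).2.2
  rw [hL] at m3 m4
  refine ⟨m3.trans (by gcongr), ?_⟩
  calc _ ≤ ENNReal.ofReal L.normDet * ((C : ℝ≥0∞) ^ k * (μHE[k] : Measure T) (p '' s)) := by
        gcongr
    _ = (C : ℝ≥0∞) ^ k * (ENNReal.ofReal L.normDet * (μHE[k] : Measure T) (p '' s)) := by ring
    _ ≤ (C : ℝ≥0∞) ^ k * ((C : ℝ≥0∞) ^ k * (μHE[k] : Measure (Space n)) (F '' s)) := by gcongr
    _ = _ := by ring

/-! ### The area formula on an oriented rectifiable set -/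

/-- By the Lindelöf property countably many neighbourhoods suffice; making them disjoint lets the
local inequalities be summed. -/
theorem measure_le_of_locally_le {X : Type*} [TopologicalSpace X] [SecondCountableTopology X]
    [MeasurableSpace X] [OpensMeasurableSpace X] {μ ν : Measure X} {K : Set X}
    (h : ∀ x ∈ K, ∃ U ∈ 𝓝 x, ∀ s, MeasurableSet s → s ⊆ K ∩ U → μ s ≤ ν s)
    {s : Set X} (hs : MeasurableSet s) (hsK : s ⊆ K) : μ s ≤ ν s := by
  choose! U hU h using h
  obtain ⟨t, htK, ht, hcov⟩ := TopologicalSpace.countable_cover_nhdsWithin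
    (s := K) (f := fun x => interior (U x))
    fun x hx => mem_nhdsWithin_of_mem_nhds (interior_mem_nhds.2 (hU x hx))
  rcases s.eq_empty_or_nonempty with rfl | ⟨y, hy⟩
  · simp
  have hne : t.Nonempty := by
    obtain ⟨x, hx, -⟩ := mem_iUnion₂.1 (hcov (hsK hy))
    exact ⟨x, hx⟩
  obtain ⟨e, rfl⟩ := ht.exists_eq_range hne
  set V : ℕ → Set X := disjointed fun i => interior (U (e i))
  have hVm : ∀ i, MeasurableSet (V i) := fun i =>
    MeasurableSet.disjointed (fun j => isOpen_interior.measurableSet) i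
  have hsV : s = ⋃ i, s ∩ V i := by
    rw [← inter_iUnion, iUnion_disjointed, inter_eq_left.2]
    simpa using hsK.trans hcov
  have hdisj : Pairwise (Function.onFun Disjoint fun i => s ∩ V i) := fun i j hij =>
    (disjoint_disjointed _ hij).mono inter_subset_right inter_subset_right
  rw [hsV, measure_iUnion hdisj fun i => hs.inter (hVm i),
    measure_iUnion hdisj fun i => hs.inter (hVm i)]
  refine ENNReal.tsum_le_tsum fun i => h _ (htK (mem_range_self i)) _ (hs.inter (hVm i)) ?_
  exact fun x hx => ⟨hsK hx.1, interior_subset (disjointed_subset _ i hx.2)⟩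

theorem le_of_forall_one_lt_pow_mul {a b : ℝ≥0∞} (m : ℕ)
    (h : ∀ C : ℝ≥0, 1 < C → a ≤ (C : ℝ≥0∞) ^ m * b) : a ≤ b := by
  have : Tendsto (fun C : ℝ≥0 => (C : ℝ≥0∞) ^ m * b) (𝓝[>] 1) (𝓝 (((1 : ℝ≥0) : ℝ≥0∞) ^ m * b)) := by
    refine Tendsto.mono_left ?_ nhdsWithin_le_nhds
    -- The limit `1` is nonzero, so the product converges even when `b = ∞`.
    refine ENNReal.Tendsto.mul_const ?_ (Or.inl (by simp))
    exact ((ENNReal.continuous_pow m).comp ENNReal.continuous_coe).tendsto _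
  simp only [ENNReal.coe_one, one_pow, one_mul] at this
  exact ge_of_tendsto this (eventually_nhdsWithin_of_forall fun C hC => h C hC)

section Area

variable {n k : ℕ} {φ : OpenPartialHomeomorph (Space n) (Space n)}

theorem extMap_symm_extMap (h : ContDiffOn ℝ 1 φ φ.source) (h' : ContDiffOn ℝ 1 φ.symm φ.target)
    {x : Space n} (hx : x ∈ φ.source) (ξ : KVector n k) :
    extMap k (fderiv ℝ φ.symm (φ x)) (extMap k (fderiv ℝ φ x) ξ) = ξ := by
  rw [← extMap_comp, fderiv_symm_comp_fderiv h h' hx, extMap_id]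

theorem extMap_fderiv_ne_zero (h : ContDiffOn ℝ 1 φ φ.source)
    (h' : ContDiffOn ℝ 1 φ.symm φ.target) {x : Space n} (hx : x ∈ φ.source) {ξ : KVector n k}
    (hξ : ‖ξ‖ = 1) : extMap k (fderiv ℝ φ x) ξ ≠ 0 := fun h0 => by
  have := extMap_symm_extMap h h' hx ξ
  rw [h0, map_zero] at this
  simp [← this] at hξ

theorem continuousOn_extMap_fderiv (h : ContDiffOn ℝ 1 φ φ.source) {τ : Space n → KVector n k}
    {K : Set (Space n)} (hK : K ⊆ φ.source) (hτ : ContinuousOn τ K) :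
    ContinuousOn (fun x => extMap k (fderiv ℝ φ x) (τ x)) K :=
  ((continuous_extMap k).comp_continuousOn
    ((h.continuousOn_fderiv_of_isOpen φ.open_source le_rfl).mono hK)).clm_apply hτ

/-- This realizes `s ↦ μ (φ '' s)` as a measure, to which local comparison of measures applies. -/
theorem map_symm_restrict_apply (μ : Measure (Space n)) {s : Set (Space n)}
    (hs : MeasurableSet s) (hsφ : s ⊆ φ.source) :
    Measure.map φ.symm (μ.restrict φ.target) s = μ (φ '' s) := by
  rw [Measure.map_apply_of_aemeasurable
    (φ.continuousOn_symm.aemeasurable φ.open_target.measurableSet) hs,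
    Measure.restrict_apply₀' φ.open_target.measurableSet.nullMeasurableSet, inter_comm,
    ← φ.image_source_inter_eq' s, inter_eq_right.2 hsφ]

/-- The Jacobian is continuous on `K` and positive at `x₀`, so freezing it at `x₀` costs one more
factor `C`, whence the exponent `2 * k + 1`. -/
theorem exists_nhds_measure_image_le_lintegral (h : ContDiffOn ℝ 1 φ φ.source)
    (h' : ContDiffOn ℝ 1 φ.symm φ.target) {τ : Space n → KVector n k} {K M : Set (Space n)}
    (hK : K ⊆ φ.source) (hKM : K ⊆ M) (hτ : ContinuousOn τ K) {x₀ : Space n} (hx₀ : x₀ ∈ K)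
    {T : Submodule ℝ (Space n)} (hT : IsTangentSpace M x₀ T) (hξ : IsUnitSimple (τ x₀) T)
    {C : ℝ≥0} (hC : 1 < C) :
    ∃ U ∈ 𝓝 x₀, ∀ s, MeasurableSet s → s ⊆ K ∩ U →
      (μHE[k] : Measure (Space n)) (φ '' s) ≤ (C : ℝ≥0∞) ^ (2 * k + 1) *
        ∫⁻ x in s, ENNReal.ofReal ‖extMap k (fderiv ℝ φ x) (τ x)‖ ∂μHE[k] ∧
      ∫⁻ x in s, ENNReal.ofReal ‖extMap k (fderiv ℝ φ x) (τ x)‖ ∂μHE[k] ≤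
        (C : ℝ≥0∞) ^ (2 * k + 1) * (μHE[k] : Measure (Space n)) (φ '' s) := by
  set J : Space n → ℝ := fun x => ‖extMap k (fderiv ℝ φ x) (τ x)‖
  have hJ : ContinuousOn J K := (continuousOn_extMap_fderiv h hK hτ).norm
  have hJ0 : 0 < J x₀ := norm_pos_iff.2 (extMap_fderiv_ne_zero h h' (hK hx₀) hξ.1)
  obtain ⟨U, hU, hUs⟩ := hT.exists_nhds_measure_image_le hξ.finrank_eq
    (hasStrictFDerivAt_of_contDiffOn h (hK hx₀)) (injective_fderiv h h' (hK hx₀)) hC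
  rw [← hξ.norm_extMap] at hUs
  have hC' : (1 : ℝ) < C := by exact_mod_cast hC
  have t1 : ∀ᶠ x in 𝓝[K] x₀, J x < C * J x₀ :=
    (hJ x₀ hx₀).eventually_lt_const (lt_mul_of_one_lt_left hJ0 hC')
  have t2 : ∀ᶠ x in 𝓝[K] x₀, J x₀ < C * J x :=
    (((hJ x₀ hx₀).const_mul (C : ℝ))).eventually_const_lt (lt_mul_of_one_lt_left hJ0 hC')
  obtain ⟨V, hV, hVK⟩ := mem_nhdsWithin_iff_exists_mem_nhds_inter.1 (t1.and t2)
  refine ⟨U ∩ V, inter_mem hU hV, fun s hsm hs => ?_⟩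
  obtain ⟨u1, u2⟩ := hUs s fun x hx => ⟨hKM (hs hx).1, (hs hx).2.1⟩
  have hJs : ∀ x ∈ s, ENNReal.ofReal (J x) ≤ C * ENNReal.ofReal (J x₀) ∧
      ENNReal.ofReal (J x₀) ≤ C * ENNReal.ofReal (J x) := fun x hx => by
    have := hVK ⟨(hs hx).2.2, (hs hx).1⟩
    rw [← ENNReal.ofReal_coe_nnreal, ← ENNReal.ofReal_mul C.coe_nonneg,
      ← ENNReal.ofReal_mul C.coe_nonneg]
    exact ⟨ENNReal.ofReal_le_ofReal this.1.le, ENNReal.ofReal_le_ofReal this.2.le⟩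
  have hCone : (1 : ℝ≥0∞) ≤ C := by exact_mod_cast hC.le
  constructor
  · calc _ ≤ (C : ℝ≥0∞) ^ k * (ENNReal.ofReal (J x₀) * (μHE[k] : Measure (Space n)) s) := u1
      _ = (C : ℝ≥0∞) ^ k * ∫⁻ _ in s, ENNReal.ofReal (J x₀) ∂μHE[k] := by
        rw [setLIntegral_const]
      _ ≤ (C : ℝ≥0∞) ^ k * ∫⁻ x in s, C * ENNReal.ofReal (J x) ∂μHE[k] := by
        exact mul_le_mul_right (setLIntegral_mono' hsm fun x hx => (hJs x hx).2) _
      _ = (C : ℝ≥0∞) ^ (k + 1) * ∫⁻ x in s, ENNReal.ofReal (J x) ∂μHE[k] := by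
        rw [lintegral_const_mul' _ _ ENNReal.coe_ne_top, pow_succ, mul_assoc]
      _ ≤ _ := by
        exact mul_le_mul_left (pow_le_pow_right₀ hCone (by omega)) _
  · calc _ ≤ ∫⁻ _ in s, C * ENNReal.ofReal (J x₀) ∂μHE[k] :=
        setLIntegral_mono' hsm fun x hx => (hJs x hx).1
      _ = C * (ENNReal.ofReal (J x₀) * (μHE[k] : Measure (Space n)) s) := by
        rw [setLIntegral_const, mul_assoc]
      _ ≤ C * ((C : ℝ≥0∞) ^ (2 * k) * (μHE[k] : Measure (Space n)) (φ '' s)) := by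
        gcongr
      _ = _ := by ring

theorem measure_image_eq_lintegral_piece (h : ContDiffOn ℝ 1 φ φ.source)
    (h' : ContDiffOn ℝ 1 φ.symm φ.target) {τ : Space n → KVector n k} {K M : Set (Space n)}
    (hK : K ⊆ φ.source) (hKM : K ⊆ M) (hτ : ContinuousOn τ K)
    (hT : ∀ x ∈ K, ∃ T, IsTangentSpace M x T ∧ IsUnitSimple (τ x) T)
    {s : Set (Space n)} (hs : MeasurableSet s) (hsK : s ⊆ K) :
    (μHE[k] : Measure (Space n)) (φ '' s) =
      ∫⁻ x in s, ENNReal.ofReal ‖extMap k (fderiv ℝ φ x) (τ x)‖ ∂μHE[k] := by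
  set μ : Measure (Space n) := μHE[k]
  set ν := Measure.map φ.symm (μ.restrict φ.target)
  set ρ := μ.withDensity fun x => ENNReal.ofReal ‖extMap k (fderiv ℝ φ x) (τ x)‖
  have hν : ∀ t, MeasurableSet t → t ⊆ K → ν t = μ (φ '' t) := fun t ht htK =>
    map_symm_restrict_apply μ ht (htK.trans hK)
  rw [← hν s hs hsK, ← withDensity_apply _ hs]
  apply le_antisymm
  · refine le_of_forall_one_lt_pow_mul (2 * k + 1) fun C hC => ?_
    rw [← smul_eq_mul, ← Measure.smul_apply]
    refine measure_le_of_locally_le (fun x hx => ?_) hs hsK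
    obtain ⟨T, hT1, hT2⟩ := hT x hx
    obtain ⟨U, hU, hUs⟩ :=
      exists_nhds_measure_image_le_lintegral h h' hK hKM hτ hx hT1 hT2 hC
    refine ⟨U, hU, fun t ht htU => ?_⟩
    rw [hν t ht (htU.trans inter_subset_left), Measure.smul_apply, withDensity_apply _ ht]
    exact (hUs t ht htU).1
  · refine le_of_forall_one_lt_pow_mul (2 * k + 1) fun C hC => ?_
    rw [← smul_eq_mul, ← Measure.smul_apply]
    refine measure_le_of_locally_le (fun x hx => ?_) hs hsK
    obtain ⟨T, hT1, hT2⟩ := hT x hx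
    obtain ⟨U, hU, hUs⟩ :=
      exists_nhds_measure_image_le_lintegral h h' hK hKM hτ hx hT1 hT2 hC
    refine ⟨U, hU, fun t ht htU => ?_⟩
    rw [Measure.smul_apply, hν t ht (htU.trans inter_subset_left), withDensity_apply _ ht]
    exact (hUs t ht htU).2

theorem measurableSet_image_of_subset_source {s : Set (Space n)} (hs : MeasurableSet s)
    (hsφ : s ⊆ φ.source) : MeasurableSet (φ '' s) :=
  hs.image_of_continuousOn_injOn (φ.continuousOn.mono hsφ) (φ.injOn.mono hsφ)

theorem measure_image_eq_lintegral (h : ContDiffOn ℝ 1 φ φ.source)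
    (h' : ContDiffOn ℝ 1 φ.symm φ.target) {τ : Space n → KVector n k} {K M : ℕ → Set (Space n)}
    (hKm : ∀ j, MeasurableSet (K j)) (hKd : ∀ i j, i ≠ j → Disjoint (K i) (K j))
    (hKM : ∀ j, K j ⊆ M j) (hK : (⋃ j, K j) ⊆ φ.source) (hτ : ContinuousOn τ (⋃ j, K j))
    (hT : ∀ j, ∀ x ∈ K j, ∃ T, IsTangentSpace (M j) x T ∧ IsUnitSimple (τ x) T)
    {s : Set (Space n)} (hs : MeasurableSet s) (hsK : s ⊆ ⋃ j, K j) :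
    (μHE[k] : Measure (Space n)) (φ '' s) =
      ∫⁻ x in s, ENNReal.ofReal ‖extMap k (fderiv ℝ φ x) (τ x)‖ ∂μHE[k] := by
  have hs' : s = ⋃ j, s ∩ K j := by rw [← inter_iUnion, inter_eq_left.2 hsK]
  have hd : Pairwise (Function.onFun Disjoint fun j => s ∩ K j) := fun i j hij =>
    (hKd i j hij).mono inter_subset_right inter_subset_right
  have hm : ∀ j, MeasurableSet (s ∩ K j) := fun j => hs.inter (hKm j)
  have hsub : ∀ j, K j ⊆ ⋃ j, K j := subset_iUnion K
  have hsource : ∀ j, s ∩ K j ⊆ φ.source := fun j =>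
    inter_subset_right.trans ((hsub j).trans hK)
  conv_lhs => rw [hs']
  conv_rhs => rw [hs']
  rw [image_iUnion, lintegral_iUnion hm hd, measure_iUnion]
  · exact tsum_congr fun j => measure_image_eq_lintegral_piece h h' ((hsub j).trans hK) (hKM j)
      (hτ.mono (hsub j)) (hT j) (hm j) inter_subset_right
  · exact fun i j hij => (hd hij).image φ.injOn (hsource i) (hsource j)
  · exact fun j => measurableSet_image_of_subset_source (hm j) (hsource j)

/-- The area formula as an identity of measures, ready for integrating functions. Continuity of `φ`
only on its source gives a.e. measurability, hence the null-measurable preimages. -/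
theorem map_withDensity_eq_restrict_image
    {μ : Measure (Space n)} {τ : Space n → KVector n k} {K : Set (Space n)}
    (hKm : MeasurableSet K) (hK : K ⊆ φ.source)
    (hμ : ∀ s, MeasurableSet s → s ⊆ K → μ (φ '' s) =
      ∫⁻ x in s, ENNReal.ofReal ‖extMap k (fderiv ℝ φ x) (τ x)‖ ∂μ) :
    Measure.map φ ((μ.restrict K).withDensity
      fun x => ENNReal.ofReal ‖extMap k (fderiv ℝ φ x) (τ x)‖) = μ.restrict (φ '' K) := by
  have hφ : AEMeasurable φ (μ.restrict K) := (φ.continuousOn.mono hK).aemeasurable hKm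
  refine Measure.ext fun t ht => ?_
  have h1 : NullMeasurableSet (φ ⁻¹' t) (μ.restrict K) := hφ.nullMeasurableSet_preimage ht
  have h2 : MeasurableSet (φ ⁻¹' t ∩ K) := by
    rw [inter_comm, ← Subtype.image_preimage_coe]
    exact hKm.subtype_image ((continuousOn_iff_continuous_domRestrict.1
      (φ.continuousOn.mono hK)).measurable ht)
  rw [Measure.map_apply_of_aemeasurable (hφ.mono_ac (withDensity_absolutelyContinuous _ _)) ht,
    withDensity_apply₀ _ h1, Measure.restrict_apply ht, Measure.restrict_restrict₀ h1,
    ← hμ _ h2 inter_subset_right, image_preimage_inter]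

theorem setIntegral_image_eq (h : ContDiffOn ℝ 1 φ φ.source)
    {μ : Measure (Space n)} {τ : Space n → KVector n k} {K : Set (Space n)}
    (hKm : MeasurableSet K) (hK : K ⊆ φ.source) (hτ : ContinuousOn τ K)
    (hμ : ∀ s, MeasurableSet s → s ⊆ K → μ (φ '' s) =
      ∫⁻ x in s, ENNReal.ofReal ‖extMap k (fderiv ℝ φ x) (τ x)‖ ∂μ)
    {g : Space n → ℝ} (hg : AEStronglyMeasurable g (μ.restrict (φ '' K))) :
    ∫ y in φ '' K, g y ∂μ = ∫ x in K, ‖extMap k (fderiv ℝ φ x) (τ x)‖ * g (φ x) ∂μ := by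
  have hmap := map_withDensity_eq_restrict_image hKm hK hμ
  have hφ : AEMeasurable φ (μ.restrict K) := (φ.continuousOn.mono hK).aemeasurable hKm
  have hJ : AEMeasurable (fun x => ENNReal.ofReal ‖extMap k (fderiv ℝ φ x) (τ x)‖)
      (μ.restrict K) :=
    ((continuousOn_extMap_fderiv h hK hτ).norm.aemeasurable hKm).ennreal_ofReal
  rw [← hmap] at hg ⊢
  rw [integral_map (hφ.mono_ac (withDensity_absolutelyContinuous _ _)) hg,
    integral_withDensity_eq_integral_toReal_smul₀ hJ (by simp)]
  simp

end Area

/-! ### Transport of oriented rectifiable sets -/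

section Transport

variable {n k : ℕ} {φ : OpenPartialHomeomorph (Space n) (Space n)}

/-- The chart `Φ ∘ φ⁻¹` flattens the image onto the same `L`; the chain rule gives the tangent
space. -/
theorem IsTangentSpace.image (h : ContDiffOn ℝ 1 φ φ.source) (h' : ContDiffOn ℝ 1 φ.symm φ.target)
    {M : Set (Space n)} {x : Space n} {T : Submodule ℝ (Space n)} (hT : IsTangentSpace M x T)
    (hx : x ∈ φ.source) :
    IsTangentSpace (φ '' (M ∩ φ.source)) (φ x)
      (T.map (fderiv ℝ φ x : Space n →ₗ[ℝ] Space n)) := by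
  obtain ⟨Φ, L, h1, h2, hxM, hxΦ, him, rfl⟩ := hT
  refine ⟨φ.symm.trans Φ, L, ?_, ?_, mem_image_of_mem φ ⟨hxM, hx⟩, ?_, ?_, ?_⟩
  · rw [OpenPartialHomeomorph.coe_trans, OpenPartialHomeomorph.trans_source]
    exact h1.comp (h'.mono inter_subset_left) fun y hy => hy.2
  · rw [OpenPartialHomeomorph.trans_symm_eq_symm_trans_symm, OpenPartialHomeomorph.coe_trans,
      OpenPartialHomeomorph.trans_target]
    exact h.comp (h2.mono inter_subset_left) fun y hy => hy.2
  · rw [OpenPartialHomeomorph.trans_source]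
    refine ⟨φ.map_source hx, ?_⟩
    rwa [mem_preimage, φ.left_inv hx]
  · rw [OpenPartialHomeomorph.coe_trans, OpenPartialHomeomorph.trans_source,
      OpenPartialHomeomorph.trans_target]
    ext w
    constructor
    · rintro ⟨_, ⟨⟨z, ⟨hzM, hz⟩, rfl⟩, -, hzΦ⟩, rfl⟩
      rw [mem_preimage, φ.left_inv hz] at hzΦ
      rw [Function.comp_apply, φ.left_inv hz]
      have := him.subset (mem_image_of_mem Φ ⟨hzM, hzΦ⟩)
      refine ⟨this.1, this.2, ?_⟩
      rw [mem_preimage, Φ.left_inv hzΦ]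
      exact hz
    · rintro ⟨hwL, hwt, hws⟩
      obtain ⟨z, ⟨hzM, hzΦ⟩, rfl⟩ := him.superset ⟨hwL, hwt⟩
      rw [mem_preimage, Φ.left_inv hzΦ] at hws
      refine ⟨φ z, ⟨mem_image_of_mem φ ⟨hzM, hws⟩, φ.map_source hws, ?_⟩, ?_⟩
      · rwa [mem_preimage, φ.left_inv hws]
      · rw [Function.comp_apply, φ.left_inv hws]
  · have d1 := (hasStrictFDerivAt_of_contDiffOn (φ := φ.symm) h' (φ.map_source hx)).hasFDerivAt
    have d2 : HasFDerivAt Φ (fderiv ℝ Φ x) (φ.symm (φ x)) := by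
      rw [φ.left_inv hx]
      exact (hasStrictFDerivAt_of_contDiffOn h1 hxΦ).hasFDerivAt
    rw [OpenPartialHomeomorph.coe_trans, (d2.comp _ d1).fderiv]
    ext v
    constructor
    · rintro ⟨u, hu, rfl⟩
      change fderiv ℝ Φ x (fderiv ℝ φ.symm (φ x) (fderiv ℝ φ x u)) ∈ L
      rw [fderiv_symm_apply_fderiv h h' hx]
      exact hu
    · intro hv
      exact ⟨fderiv ℝ φ.symm (φ x) v, hv, fderiv_apply_fderiv_symm h h' hx v⟩

theorem IsC1Submanifold.image (h : ContDiffOn ℝ 1 φ φ.source)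
    (h' : ContDiffOn ℝ 1 φ.symm φ.target) {M : Set (Space n)} (hM : IsC1Submanifold k M) :
    IsC1Submanifold k (φ '' (M ∩ φ.source)) := by
  rintro _ ⟨x, ⟨hxM, hx⟩, rfl⟩
  obtain ⟨T, hk, hT⟩ := hM x hxM
  refine ⟨_, ?_, hT.image h h' hx⟩
  rw [← hk]
  exact (Submodule.equivMapOfInjective _ (injective_fderiv h h' hx) T).finrank_eq.symm

theorem IsUnitSimple.image {ξ : KVector n k} {T : Submodule ℝ (Space n)} (hξ : IsUnitSimple ξ T)
    {A : Space n →L[ℝ] Space n} (hA : Function.Injective A) (h0 : extMap k A ξ ≠ 0) :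
    IsUnitSimple (‖extMap k A ξ‖⁻¹ • extMap k A ξ) (T.map (A : Space n →ₗ[ℝ] Space n)) := by
  obtain ⟨-, c, v, hv, rfl, hξ⟩ := hξ
  refine ⟨norm_smul_inv_norm h0, ‖extMap k A ξ‖⁻¹ * c, fun i => A (v i), ?_, ?_, ?_⟩
  · exact hv.map' (A : Space n →ₗ[ℝ] Space n) (LinearMap.ker_eq_bot.2 hA)
  · rw [Submodule.map_span, ← range_comp]
    rfl
  · rw [mul_smul]
    congr 1
    rw [hξ, map_smul, extMap_ιMulti]

theorem exists_countable_lipschitz_cover (h : ContDiffOn ℝ 1 φ φ.source) :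
    ∃ (U : ℕ → Set (Space n)) (C : ℕ → ℝ≥0), φ.source ⊆ ⋃ i, U i ∧
      ∀ i, LipschitzOnWith (C i) φ (U i) := by
  rcases φ.source.eq_empty_or_nonempty with h0 | ⟨y, hy⟩
  · exact ⟨fun _ => ∅, fun _ => 0, by simp [h0], by simp⟩
  have := fun x (hx : x ∈ φ.source) =>
    (hasStrictFDerivAt_of_contDiffOn h hx).exists_lipschitzOnWith
  choose! C U hU hC using this
  obtain ⟨t, htK, ht, hcov⟩ := TopologicalSpace.countable_cover_nhdsWithin
    fun x hx => mem_nhdsWithin_of_mem_nhds (hU x hx)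
  have hne : t.Nonempty := by
    obtain ⟨x, hx, -⟩ := mem_iUnion₂.1 (hcov hy)
    exact ⟨x, hx⟩
  obtain ⟨e, rfl⟩ := ht.exists_eq_range hne
  exact ⟨fun i => U (e i), fun i => C (e i), by simpa using hcov,
    fun i => hC _ (htK (mem_range_self i))⟩

theorem measure_image_eq_zero (h : ContDiffOn ℝ 1 φ φ.source) {Z : Set (Space n)}
    (hZ : Z ⊆ φ.source) (h0 : (μHE[k] : Measure (Space n)) Z = 0) :
    (μHE[k] : Measure (Space n)) (φ '' Z) = 0 := by
  obtain ⟨U, C, hU, hC⟩ := exists_countable_lipschitz_cover h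
  have : φ '' Z ⊆ ⋃ i, φ '' (Z ∩ U i) := by
    rw [← image_iUnion, ← inter_iUnion, inter_eq_left.2 (hZ.trans hU)]
  refine measure_mono_null this (measure_iUnion_null fun i => ?_)
  refine le_antisymm ((euclideanHausdorffMeasure_image_le_of_lipschitzOnWith
    ((hC i).mono inter_subset_right) k).trans ?_) zero_le
  rw [measure_mono_null inter_subset_left h0, mul_zero]

/-- Local Lipschitz bounds have no common constant on the source; compactness of `E` reduces to
finitely many of them. -/
theorem measure_image_lt_top (h : ContDiffOn ℝ 1 φ φ.source) {S E : Set (Space n)}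
    (hE : IsCompact E) (hEφ : E ⊆ φ.source) (hS : S ⊆ E)
    (htop : (μHE[k] : Measure (Space n)) S < ∞) :
    (μHE[k] : Measure (Space n)) (φ '' S) < ∞ := by
  have key : (μHE[k] : Measure (Space n)) (φ '' (S ∩ E)) < ∞ := by
    refine hE.induction_on (p := fun t => (μHE[k] : Measure (Space n)) (φ '' (S ∩ t)) < ∞)
      (by simp) (fun s t hst ht => (measure_mono (by gcongr)).trans_lt ht) (fun s t hs ht => ?_)
      fun x hx => ?_
    · rw [inter_union_distrib_left, image_union]
      exact (measure_union_le _ _).trans_lt (ENNReal.add_lt_top.2 ⟨hs, ht⟩)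
    · obtain ⟨C, U, hU, hC⟩ :=
        (hasStrictFDerivAt_of_contDiffOn h (hEφ hx)).exists_lipschitzOnWith
      refine ⟨U, mem_nhdsWithin_of_mem_nhds hU,
        (euclideanHausdorffMeasure_image_le_of_lipschitzOnWith
          (hC.mono inter_subset_right) k).trans_lt ?_⟩
      exact ENNReal.mul_lt_top (by simp) ((measure_mono inter_subset_left).trans_lt htop)
  rwa [inter_eq_left.2 hS] at key

theorem IsRectifiable.image (h : ContDiffOn ℝ 1 φ φ.source) {S : Set (Space n)}
    (hSφ : S ⊆ φ.source) (hS : IsRectifiable k S) : IsRectifiable k (φ '' S) := by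
  obtain ⟨f, hf, h0⟩ := hS
  obtain ⟨U, C, hU, hC⟩ := exists_countable_lipschitz_cover h
  -- Each `φ ∘ f j` is Lipschitz only over a piece `U i` of the source, so its restriction there is
  -- extended to all of `ℝᵏ`.
  have hext : ∀ p : ℕ × ℕ, ∃ g : Space k → Space n, (∃ C, LipschitzWith C g) ∧
      EqOn (φ ∘ f p.1) g (f p.1 ⁻¹' U p.2) := fun p => by
    obtain ⟨D, hD⟩ := hf p.1
    obtain ⟨g, hg, hg'⟩ := ((hC p.2).comp (hD.lipschitzOnWith (s := f p.1 ⁻¹' U p.2))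
      (mapsTo_preimage _ _)).extend_finite_dimension
    exact ⟨g, ⟨_, hg⟩, hg'⟩
  choose g hg hgf using hext
  refine ⟨fun i => g i.unpair, fun i => hg _, ?_⟩
  refine measure_mono_null ?_ (measure_image_eq_zero h (sdiff_subset.trans hSφ) h0)
  rintro _ ⟨⟨x, hx, rfl⟩, hxg⟩
  refine mem_image_of_mem φ ⟨hx, fun hxf => hxg ?_⟩
  obtain ⟨j, y, rfl⟩ := mem_iUnion.1 hxf
  obtain ⟨i, hi⟩ := mem_iUnion.1 (hU (hSφ hx))
  refine mem_iUnion.2 ⟨Nat.pair j i, y, ?_⟩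
  simp only [Nat.unpair_pair]
  exact (hgf (j, i) hi).symm

theorem IsOrientation.norm_eq_one_of_mem {τ : Space n → KVector n k} {K M : ℕ → Set (Space n)}
    (hT : ∀ j, ∀ x ∈ K j, ∃ T, IsTangentSpace (M j) x T ∧ IsUnitSimple (τ x) T) {x : Space n}
    (hx : x ∈ ⋃ j, K j) : ‖τ x‖ = 1 := by
  obtain ⟨j, hj⟩ := mem_iUnion.1 hx
  obtain ⟨T, -, hT⟩ := hT j x hj
  exact hT.1

theorem IsOrientation.push (h : ContDiffOn ℝ 1 φ φ.source) (h' : ContDiffOn ℝ 1 φ.symm φ.target)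
    {S : KSet n k} (hSφ : S.carrier ⊆ φ.source) (hS : IsOrientation S.carrier S.orient) :
    IsOrientation (S.push φ).carrier (S.push φ).orient := by
  obtain ⟨K, M, hKm, hKd, hM, hKM, hKS, h0, hτ, hT⟩ := hS
  have hsub : ∀ j, K j ⊆ ⋃ j, K j := subset_iUnion K
  have hKφ : ∀ j, K j ⊆ φ.source := fun j => (hsub j).trans (hKS.trans hSφ)
  refine ⟨fun j => φ '' K j, fun j => φ '' (M j ∩ φ.source),
    fun j => measurableSet_image_of_subset_source (hKm j) (hKφ j),
    fun i j hij => (hKd i j hij).image φ.injOn (hKφ i) (hKφ j),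
    fun j => (hM j).image h h', fun j => image_mono (subset_inter (hKM j) (hKφ j)), ?_, ?_, ?_, ?_⟩
  · rw [← image_iUnion]
    exact image_mono hKS
  · rw [← image_iUnion]
    refine measure_mono_null ?_ (measure_image_eq_zero h (sdiff_subset.trans hSφ) h0)
    rintro _ ⟨⟨x, hx, rfl⟩, hx'⟩
    exact mem_image_of_mem φ ⟨hx, fun h => hx' (mem_image_of_mem φ h)⟩
  · rw [← image_iUnion]
    have hc := continuousOn_extMap_fderiv h (hKS.trans hSφ) hτ
    have hc2 : ContinuousOn (fun x => ‖extMap k (fderiv ℝ φ x) (S.orient x)‖⁻¹ •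
        extMap k (fderiv ℝ φ x) (S.orient x)) (⋃ j, K j) :=
      (hc.norm.inv₀ fun x hx => norm_ne_zero_iff.2 (extMap_fderiv_ne_zero h h'
        (hSφ (hKS hx)) (IsOrientation.norm_eq_one_of_mem hT hx))).smul hc
    refine hc2.comp (φ.continuousOn_symm.mono ?_) ?_
    · rintro _ ⟨x, hx, rfl⟩
      exact φ.map_source (hSφ (hKS hx))
    · rintro _ ⟨x, hx, rfl⟩
      rwa [φ.left_inv (hSφ (hKS hx))]
  · rintro j _ ⟨x, hx, rfl⟩
    obtain ⟨T, hT1, hT2⟩ := hT j x hx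
    refine ⟨_, hT1.image h h' (hKφ j hx), ?_⟩
    simp only [KSet.push, φ.left_inv (hKφ j hx)]
    exact hT2.image (injective_fderiv h h' (hKφ j hx))
      (extMap_fderiv_ne_zero h h' (hKφ j hx) hT2.1)

theorem IsC1Diffeo.symm {Ehat E : Set (Space n)} (hφ : IsC1Diffeo φ Ehat E) :
    IsC1Diffeo φ.symm E Ehat where
  contDiffOn := hφ.contDiffOn_symm
  contDiffOn_symm := hφ.contDiffOn
  subset_source := by
    rw [← hφ.image_eq]
    rintro _ ⟨x, hx, rfl⟩
    exact φ.map_source (hφ.subset_source hx)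
  image_eq := by
    rw [← hφ.image_eq]
    exact φ.toPartialEquiv.symm_image_image_of_subset_source hφ.subset_source

theorem IsC1Diffeo.isCompact {Ehat E : Set (Space n)} (hφ : IsC1Diffeo φ Ehat E)
    (h : IsCompact Ehat) : IsCompact E := by
  rw [← hφ.image_eq]
  exact h.image_of_continuousOn (φ.continuousOn.mono hφ.subset_source)

theorem KSet.IsOrientedRectifiable.push {Ehat E : Set (Space n)} (hφ : IsC1Diffeo φ Ehat E)
    (hE : IsCompact Ehat) {S : KSet n k} (hS : S.IsOrientedRectifiable Ehat) :
    (S.push φ).IsOrientedRectifiable E where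
  subset := by
    rw [← hφ.image_eq]
    exact image_mono hS.subset
  nullMeasurableSet := by
    obtain ⟨K, M, hKm, -, -, -, hKS, h0, -, -⟩ := hS.isOrientation
    have hSφ := hS.subset.trans hφ.subset_source
    change NullMeasurableSet (φ '' S.carrier) _
    rw [← union_sdiff_cancel hKS, image_union]
    exact (measurableSet_image_of_subset_source (MeasurableSet.iUnion hKm)
      (hKS.trans hSφ)).nullMeasurableSet.union
      (NullMeasurableSet.of_null
        (measure_image_eq_zero hφ.contDiffOn (sdiff_subset.trans hSφ) h0))
  isRectifiable := hS.isRectifiable.image hφ.contDiffOn (hS.subset.trans hφ.subset_source)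
  pos := by
    have hSφ := hS.subset.trans hφ.subset_source
    -- A null image would be carried back by `φ.symm` to a null set.
    refine pos_iff_ne_zero.2 fun h0 => hS.pos.ne' ?_
    have := measure_image_eq_zero (φ := φ.symm) hφ.contDiffOn_symm (Z := φ '' S.carrier) ?_ h0
    · have himg : φ.symm '' (φ '' S.carrier) = S.carrier :=
        φ.toPartialEquiv.symm_image_image_of_subset_source hSφ
      rwa [himg] at this
    · rintro _ ⟨x, hx, rfl⟩
      exact φ.map_source (hSφ hx)
  lt_top := measure_image_lt_top hφ.contDiffOn hE hφ.subset_source hS.subset hS.lt_top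
  isOrientation := hS.isOrientation.push hφ.contDiffOn hφ.contDiffOn_symm
    (hS.subset.trans hφ.subset_source)

end Transport

section Averages

variable {n k : ℕ} {φ : OpenPartialHomeomorph (Space n) (Space n)}

/-! ### Change of variables for integrals of forms and for volumes -/

open Classical in
theorem continuousOn_form_apply {E K : Set (Space n)} (hKE : K ⊆ E) (ω : Form k E)
    {τ : Space n → KVector n k} (hτ : ContinuousOn τ K) :
    ContinuousOn (fun x => if h : x ∈ E then ω ⟨x, h⟩ (τ x) else 0) K := by
  rw [continuousOn_iff_continuous_domRestrict] at hτ ⊢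
  have hc : Continuous fun x : K => ω ⟨x, hKE x.2⟩ (τ x) :=
    (ω.continuous.comp (continuous_subtype_val.subtype_mk fun x : K => hKE x.2)).clm_apply hτ
  refine hc.congr fun x => ?_
  simp [hKE x.2]

theorem ae_eq_of_subset_of_measure_diff {μ : Measure (Space n)} {K S : Set (Space n)} (hKS : K ⊆ S)
    (h0 : μ (S \ K) = 0) : S =ᵐ[μ] K :=
  (ae_le_set.2 h0).antisymm hKS.eventuallyLE

theorem KSet.IsOrientedRectifiable.integral_push {Ehat E : Set (Space n)}
    (hφ : IsC1Diffeo φ Ehat E) {S : KSet n k} (hS : S.IsOrientedRectifiable Ehat)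
    (ω : Form k E) : integral (S.push φ) ω = integral S (pullback k hφ ω) := by
  classical
  have hSφ := hS.subset.trans hφ.subset_source
  -- The regular part of the image serves only to make the integrand on `φ(S)` measurable.
  obtain ⟨K', M', hKm', -, -, -, hKS', h0', hτ', -⟩ :=
    hS.isOrientation.push hφ.contDiffOn hφ.contDiffOn_symm hSφ
  obtain ⟨K, M, hKm, hKd, hM, hKM, hKS, h0, hτ, hT⟩ := hS.isOrientation
  set μ : Measure (Space n) := μHE[k]
  have hKφ := hKS.trans hSφ
  have e1 : S.carrier =ᵐ[μ] ⋃ j, K j := ae_eq_of_subset_of_measure_diff hKS h0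
  have e2 : φ '' S.carrier =ᵐ[μ] φ '' ⋃ j, K j := by
    refine ae_eq_of_subset_of_measure_diff (image_mono hKS) ?_
    refine measure_mono_null ?_
      (measure_image_eq_zero hφ.contDiffOn (sdiff_subset.trans hSφ) h0)
    rintro _ ⟨⟨x, hx, rfl⟩, hx'⟩
    exact mem_image_of_mem φ ⟨hx, fun h => hx' (mem_image_of_mem φ h)⟩
  have e3 : φ '' S.carrier =ᵐ[μ] ⋃ j, K' j := ae_eq_of_subset_of_measure_diff hKS' h0'
  have hE : φ '' S.carrier ⊆ E := by
    rw [← hφ.image_eq]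
    exact image_mono hS.subset
  rw [integral, integral]
  change ∫ x in φ '' S.carrier, _ ∂μ = ∫ x in S.carrier, _ ∂μ
  rw [setIntegral_congr_set e2, setIntegral_congr_set e1,
    setIntegral_image_eq hφ.contDiffOn (MeasurableSet.iUnion hKm) hKφ hτ
      fun s hs hsK => measure_image_eq_lintegral hφ.contDiffOn hφ.contDiffOn_symm hKm hKd hKM
        hKφ hτ hT hs hsK]
  · refine setIntegral_congr_fun (MeasurableSet.iUnion hKm) fun x hx => ?_
    have hxE : x ∈ Ehat := hS.subset (hKS hx)
    have hxE' : φ x ∈ E := hφ.mem ⟨x, hxE⟩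
    have hne : ‖extMap k (fderiv ℝ φ x) (S.orient x)‖ ≠ 0 := norm_ne_zero_iff.2
      (extMap_fderiv_ne_zero hφ.contDiffOn hφ.contDiffOn_symm (hKφ hx)
        (IsOrientation.norm_eq_one_of_mem hT hx))
    simp only [hxE, hxE', dite_true, KSet.push, φ.left_inv (hKφ hx), map_smul, smul_eq_mul]
    rw [mul_inv_cancel_left₀ hne]
    rfl
  · rw [← Measure.restrict_congr_set e2, Measure.restrict_congr_set e3]
    exact (continuousOn_form_apply (hKS'.trans hE) ω hτ').aestronglyMeasurable
      (MeasurableSet.iUnion hKm')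

theorem KSet.IsOrientedRectifiable.measure_push {Ehat E : Set (Space n)}
    (hφ : IsC1Diffeo φ Ehat E) {S : KSet n k} (hS : S.IsOrientedRectifiable Ehat) :
    ∃ K ⊆ S.carrier, MeasurableSet K ∧ S.carrier =ᵐ[(μHE[k] : Measure (Space n))] K ∧
      (∀ x ∈ K, ‖S.orient x‖ = 1) ∧
      (μHE[k] : Measure (Space n)) (φ '' S.carrier) =
        ∫⁻ x in K, ENNReal.ofReal ‖extMap k (fderiv ℝ φ x) (S.orient x)‖ ∂μHE[k] := by
  have hSφ := hS.subset.trans hφ.subset_source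
  obtain ⟨K, M, hKm, hKd, hM, hKM, hKS, h0, hτ, hT⟩ := hS.isOrientation
  refine ⟨⋃ j, K j, hKS, MeasurableSet.iUnion hKm, ae_eq_of_subset_of_measure_diff hKS h0,
    fun x hx => IsOrientation.norm_eq_one_of_mem hT hx, ?_⟩
  rw [← measure_image_eq_lintegral hφ.contDiffOn hφ.contDiffOn_symm hKm hKd hKM
    (hKS.trans hSφ) hτ hT (MeasurableSet.iUnion hKm) subset_rfl]
  refine measure_congr (ae_eq_of_subset_of_measure_diff (image_mono hKS) ?_)
  refine measure_mono_null ?_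
    (measure_image_eq_zero hφ.contDiffOn (sdiff_subset.trans hSφ) h0)
  rintro _ ⟨⟨x, hx, rfl⟩, hx'⟩
  exact mem_image_of_mem φ ⟨hx, fun h => hx' (mem_image_of_mem φ h)⟩

theorem KSet.IsOrientedRectifiable.measure_push_le {Ehat E : Set (Space n)}
    (hφ : IsC1Diffeo φ Ehat E) {S : KSet n k} (hS : S.IsOrientedRectifiable Ehat) :
    (μHE[k] : Measure (Space n)) (φ '' S.carrier) ≤
      supLargest k φ Ehat * (μHE[k] : Measure (Space n)) S.carrier := by
  obtain ⟨K, hKS, hKm, hKe, h1, hK⟩ := hS.measure_push hφ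
  rw [hK, measure_congr hKe, ← setLIntegral_const]
  refine setLIntegral_mono' hKm fun x hx => ?_
  refine le_trans (ENNReal.ofReal_le_ofReal ?_) 
    (le_iSup₂ (f := fun x (_ : x ∈ Ehat) =>
      ENNReal.ofReal (∏ j ∈ Finset.range k, sigma φ x j)) x (hS.subset (hKS hx)))
  simpa [h1 x hx, sigma] using norm_extMap_le (fderiv ℝ φ x) (S.orient x)

theorem KSet.IsOrientedRectifiable.le_measure_push (hk : k ≤ n) {Ehat E : Set (Space n)}
    (hφ : IsC1Diffeo φ Ehat E) {S : KSet n k} (hS : S.IsOrientedRectifiable Ehat) :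
    (supInvSmallest k φ Ehat)⁻¹ * (μHE[k] : Measure (Space n)) S.carrier ≤
      (μHE[k] : Measure (Space n)) (φ '' S.carrier) := by
  obtain ⟨K, hKS, hKm, hKe, h1, hK⟩ := hS.measure_push hφ
  rw [hK, measure_congr hKe, ← setLIntegral_const]
  refine setLIntegral_mono' hKm fun x hx => ?_
  have hxE := hS.subset (hKS hx)
  -- Injectivity of `Dφ(x)` makes the singular values positive, so `ENNReal.ofReal` commutes with
  -- the inverse of their product.
  have hpos : ∀ j ∈ Finset.Ico (n - k) n, 0 < sigma φ x j := fun j hj =>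
    (LinearMap.injective_iff_forall_lt_finrank_singularValues_pos _).1
      (injective_fderiv hφ.contDiffOn hφ.contDiffOn_symm (hφ.subset_source hxE)) j
      (by simpa using (Finset.mem_Ico.1 hj).2)
  have h2 : ENNReal.ofReal (∏ j ∈ Finset.Ico (n - k) n, (sigma φ x j)⁻¹) ≤
      supInvSmallest k φ Ehat :=
    le_iSup₂ (f := fun x (_ : x ∈ Ehat) =>
      ENNReal.ofReal (∏ j ∈ Finset.Ico (n - k) n, (sigma φ x j)⁻¹)) x hxE
  refine (ENNReal.inv_le_inv.2 h2).trans ?_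
  rw [Finset.prod_inv_distrib, ENNReal.ofReal_inv_of_pos (Finset.prod_pos hpos), inv_inv]
  refine ENNReal.ofReal_le_ofReal ?_
  simpa [h1 x hx, sigma] using le_norm_extMap hk (fderiv ℝ φ x) (S.orient x)

/-! ### Averages as linear functionals -/

theorem KSet.IsOrientedRectifiable.vol_pos {E : Set (Space n)} {S : KSet n k}
    (hS : S.IsOrientedRectifiable E) : 0 < vol S :=
  ENNReal.toReal_pos hS.pos.ne' hS.lt_top.ne

-- The form is bounded on the compact product of `E` with the unit sphere, and `S` has finite
-- measure. Additivity of the averages rests on this.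
open Classical in
theorem KSet.IsOrientedRectifiable.integrableOn {E : Set (Space n)} (hE : IsCompact E)
    {S : KSet n k} (hS : S.IsOrientedRectifiable E) (ω : Form k E) :
    IntegrableOn (fun x => if h : x ∈ E then ω ⟨x, h⟩ (S.orient x) else 0) S.carrier
      (μHE[k] : Measure (Space n)) := by
  obtain ⟨K, M, hKm, hKd, hM, hKM, hKS, h0, hτ, hT⟩ := hS.isOrientation
  have e1 := ae_eq_of_subset_of_measure_diff hKS h0
  have hm := MeasurableSet.iUnion hKm
  have : CompactSpace E := isCompact_iff_compactSpace.1 hE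
  have hc : Continuous fun p : E × KVector n k => ω p.1 p.2 :=
    (ω.continuous.comp continuous_fst).clm_apply continuous_snd
  obtain ⟨C, hC⟩ := (isCompact_univ.prod (isCompact_sphere (0 : KVector n k) 1)
    ).exists_bound_of_continuousOn hc.continuousOn
  rw [IntegrableOn, Measure.restrict_congr_set e1]
  refine IntegrableOn.of_bound (C := C) ((measure_mono hKS).trans_lt hS.lt_top)
    ((continuousOn_form_apply (hKS.trans hS.subset) ω hτ).aestronglyMeasurable hm) ?_
  refine (ae_restrict_iff' hm).2 (Eventually.of_forall fun x hx => ?_)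
  rw [dif_pos (hS.subset (hKS hx))]
  refine hC (⟨x, hS.subset (hKS hx)⟩, S.orient x) ⟨mem_univ _, ?_⟩
  rw [mem_sphere_zero_iff_norm]
  exact IsOrientation.norm_eq_one_of_mem hT hx

theorem KSet.IsOrientedRectifiable.exists_linearMap_avg {E : Set (Space n)} (hE : IsCompact E)
    {S : KSet n k} (hS : S.IsOrientedRectifiable E) :
    ∃ a : Form k E →ₗ[ℝ] ℝ, ∀ ω, a ω = avg S ω := by
  classical
  refine ⟨{ toFun := avg S, map_add' := fun ω θ => ?_, map_smul' := fun c ω => ?_ },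
    fun ω => rfl⟩
  · simp only [avg, integral]
    rw [← mul_add, ← integral_add (hS.integrableOn hE ω) (hS.integrableOn hE θ)]
    congr 2
    funext x
    by_cases hx : x ∈ E <;> simp [hx]
  · simp only [avg, integral, RingHom.id_apply, smul_eq_mul]
    rw [mul_left_comm c, ← integral_const_mul c]
    congr 2
    funext x
    by_cases hx : x ∈ E <;> simp [hx]

theorem avg_push {Ehat E : Set (Space n)} (hφ : IsC1Diffeo φ Ehat E) {S : KSet n k}
    (hS : S.IsOrientedRectifiable Ehat) (ω : Form k E) :
    avg (S.push φ) ω = vol S / vol (S.push φ) * avg S (pullback k hφ ω) := by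
  have := hS.vol_pos.ne'
  rw [avg, avg, hS.integral_push hφ]
  field_simp

theorem pullback_symm_pullback {Ehat E : Set (Space n)} (hφ : IsC1Diffeo φ Ehat E)
    (ω : Form k E) : pullback k hφ.symm (pullback k hφ ω) = ω := by
  ext x : 1
  have hx : (x : Space n) ∈ φ.target := hφ.symm.subset_source x.2
  refine ContinuousLinearMap.ext fun ξ => ?_
  change ω ⟨φ (φ.symm x), _⟩ (extMap k (fderiv ℝ φ (φ.symm x))
    (extMap k (fderiv ℝ φ.symm x) ξ)) = ω x ξ
  have h1 := extMap_symm_extMap (φ := φ.symm) hφ.contDiffOn_symm hφ.contDiffOn hx ξ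
  rw [OpenPartialHomeomorph.symm_symm] at h1
  rw [h1]
  congr 2
  exact Subtype.ext (φ.right_inv hx)

/-! ### Independence of the orthonormal basis -/

theorem eq_sum_of_orthonormal {V ι : Type*} [AddCommMonoid V] [Module ℝ V] [Fintype ι]
    [DecidableEq ι] (B : V →ₗ[ℝ] V →ₗ[ℝ] ℝ) {η : ι → V}
    (hη : ∀ h l, B (η h) (η l) = if h = l then 1 else 0) {v : V}
    (hv : v ∈ Submodule.span ℝ (range η)) : v = ∑ l, B v (η l) • η l := by
  obtain ⟨c, rfl⟩ := (Submodule.mem_span_range_iff_exists_fun ℝ).1 hv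
  refine Finset.sum_congr rfl fun l _ => ?_
  simp [hη]

/-- Expanding `η` in `θ` inside `a` and exchanging sums, symmetry of `B` recombines the coefficients
into the expansion of `θ` in `η` inside `b`. -/
theorem sum_mul_eq_of_orthonormal {V ι : Type*} [AddCommMonoid V] [Module ℝ V] [Fintype ι]
    [DecidableEq ι] (B : V →ₗ[ℝ] V →ₗ[ℝ] ℝ) (hB : ∀ v w, B v w = B w v) {η θ : ι → V}
    (hη : ∀ h l, B (η h) (η l) = if h = l then 1 else 0)
    (hθ : ∀ h l, B (θ h) (θ l) = if h = l then 1 else 0)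
    (hspan : Submodule.span ℝ (range η) = Submodule.span ℝ (range θ)) (a b : V →ₗ[ℝ] ℝ) :
    ∑ h, a (η h) * b (η h) = ∑ h, a (θ h) * b (θ h) := by
  have h1 : ∀ h, η h = ∑ l, B (η h) (θ l) • θ l := fun h =>
    eq_sum_of_orthonormal B hθ (hspan ▸ Submodule.subset_span (mem_range_self h))
  have h2 : ∀ l, θ l = ∑ h, B (θ l) (η h) • η h := fun l =>
    eq_sum_of_orthonormal B hη (hspan ▸ Submodule.subset_span (mem_range_self l))
  calc ∑ h, a (η h) * b (η h) = ∑ h, ∑ l, B (η h) (θ l) * a (θ l) * b (η h) := by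
        refine Finset.sum_congr rfl fun h _ => ?_
        have h3 := congrArg a (h1 h)
        simp only [map_sum, map_smul, smul_eq_mul] at h3
        rw [h3, Finset.sum_mul]
    _ = ∑ l, ∑ h, B (η h) (θ l) * a (θ l) * b (η h) := Finset.sum_comm
    _ = ∑ l, a (θ l) * b (θ l) := by
        refine Finset.sum_congr rfl fun l _ => ?_
        have h3 := congrArg b (h2 l)
        simp only [map_sum, map_smul, smul_eq_mul] at h3
        rw [h3, Finset.mul_sum]
        exact Finset.sum_congr rfl fun h _ => by rw [hB]; ring

/-! ### Least squares scalar products and volume ratios under transport -/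

theorem exists_bilinear_scalarProduct {M : ℕ} {E : Set (Space n)} (hE : IsCompact E)
    {S : Fin M → KSet n k} (hS : ∀ i, (S i).IsOrientedRectifiable E) (w : Fin M → ℝ) :
    ∃ B : Form k E →ₗ[ℝ] Form k E →ₗ[ℝ] ℝ, ∀ ω θ, B ω θ = scalarProduct S w ω θ := by
  choose a ha using fun i => (hS i).exists_linearMap_avg hE
  refine ⟨∑ i, w i • (LinearMap.mul ℝ ℝ).compl₁₂ (a i) (a i), fun ω θ => ?_⟩
  simp [scalarProduct, LinearMap.sum_apply, ha, mul_assoc]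

theorem scalarProduct_comm {M : ℕ} {E : Set (Space n)} (S : Fin M → KSet n k) (w : Fin M → ℝ)
    (ω θ : Form k E) : scalarProduct S w ω θ = scalarProduct S w θ ω := by
  simp only [scalarProduct]
  exact Finset.sum_congr rfl fun i _ => by ring

/-- The two averages each contribute an inverse volume ratio, and the squared ratio in the weight
cancels them. -/
theorem scalarProduct_push {M : ℕ} {Ehat E : Set (Space n)} (hφ : IsC1Diffeo φ Ehat E)
    (hE : IsCompact Ehat) {S : Fin M → KSet n k} (hS : ∀ i, (S i).IsOrientedRectifiable Ehat)
    (w : Fin M → ℝ) (ω θ : Form k E) :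
    scalarProduct (fun i => (S i).push φ) (fun i => pushWeight φ (S i) (w i)) ω θ =
      scalarProduct S w (pullback k hφ ω) (pullback k hφ θ) := by
  simp only [scalarProduct]
  refine Finset.sum_congr rfl fun i _ => ?_
  have h1 := (hS i).vol_pos.ne'
  have h2 := ((hS i).push hφ hE).vol_pos.ne'
  rw [avg_push hφ (hS i), avg_push hφ (hS i), pushWeight]
  field_simp

theorem vol_push_le {Ehat E : Set (Space n)} (hφ : IsC1Diffeo φ Ehat E) (hE : IsCompact Ehat)
    {S : KSet n k} (hS : S.IsOrientedRectifiable Ehat) :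
    ENNReal.ofReal (vol (S.push φ) / vol S) ≤ supLargest k φ Ehat := by
  rw [ENNReal.ofReal_div_of_pos hS.vol_pos, vol, vol, ENNReal.ofReal_toReal hS.lt_top.ne,
    ENNReal.ofReal_toReal (hS.push hφ hE).lt_top.ne]
  exact ENNReal.div_le_of_le_mul (hS.measure_push_le hφ)

theorem vol_push_symm_le (hk : k ≤ n) {Ehat E : Set (Space n)} (hφ : IsC1Diffeo φ Ehat E)
    (hE : IsCompact Ehat) {R : KSet n k} (hR : R.IsOrientedRectifiable E) :
    ENNReal.ofReal (vol (R.push φ.symm) / vol R) ≤ supInvSmallest k φ Ehat := by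
  have hR' := hR.push hφ.symm (hφ.isCompact hE)
  have h1 := hR'.le_measure_push hk hφ
  have himg : φ '' (R.push φ.symm).carrier = R.carrier :=
    φ.symm.toPartialEquiv.symm_image_image_of_subset_source (hR.subset.trans hφ.symm.subset_source)
  rw [himg] at h1
  rw [ENNReal.ofReal_div_of_pos hR.vol_pos, vol, vol, ENNReal.ofReal_toReal hR.lt_top.ne,
    ENNReal.ofReal_toReal hR'.lt_top.ne]
  refine ENNReal.div_le_of_le_mul ?_
  rw [mul_comm, ← div_eq_mul_inv] at h1
  -- If it vanished, its inverse `∞` times the positive measure of `φ⁻¹(R)` would force `R` to have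
  -- infinite measure.
  have h2 : (supInvSmallest k φ Ehat) ≠ 0 := fun h0 => by
    rw [h0, ENNReal.div_zero hR'.pos.ne'] at h1
    exact hR.lt_top.ne (top_le_iff.1 h1)
  rw [mul_comm]
  exact (ENNReal.div_le_iff_le_mul (Or.inl h2) (Or.inr hR.pos.ne')).1 h1

end Averages

end LeastSquaresForms

/-! ### Comparison of the two constants -/

theorem mainTheorem4 {n k M N : ℕ} (hk : k ≤ n)
    {Ehat E : Set (LeastSquaresForms.Space n)} (hEhat : IsCompact Ehat)
    (φ : OpenPartialHomeomorph (LeastSquaresForms.Space n) (LeastSquaresForms.Space n))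
    (hφ : LeastSquaresForms.IsC1Diffeo φ Ehat E)
    (Shat : Fin M → LeastSquaresForms.KSet n k)
    (hShat : ∀ i, (Shat i).IsOrientedRectifiable Ehat)
    (what : Fin M → ℝ) (hwhat : ∀ i, 0 < what i)
    (V : Submodule ℝ (LeastSquaresForms.Form k E))
    (hdet : LeastSquaresForms.IsDetermining Shat (V.map (LeastSquaresForms.pullback k hφ)))
    (S : Fin M → LeastSquaresForms.KSet n k) (hS : ∀ i, S i = (Shat i).push φ)
    (w : Fin M → ℝ) (hw : ∀ i, w i = LeastSquaresForms.pushWeight φ (Shat i) (what i))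
    (η : Fin N → LeastSquaresForms.Form k E)
    (hη : LeastSquaresForms.IsOrthonormalBasis S w V η)
    (ηhat : Fin N → LeastSquaresForms.Form k Ehat)
    (hηhat : LeastSquaresForms.IsOrthonormalBasis Shat what
      (V.map (LeastSquaresForms.pullback k hφ)) ηhat) :
    LeastSquaresForms.lsqConstant S w η ≤
      LeastSquaresForms.supLargest k φ Ehat / (LeastSquaresForms.supInvSmallest k φ Ehat)⁻¹ *
        LeastSquaresForms.lsqConstant Shat what ηhat := by
  obtain rfl : S = fun i => (Shat i).push φ := funext hS
  obtain rfl : w = fun i => LeastSquaresForms.pushWeight φ (Shat i) (what i) := funext hw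
  obtain ⟨B, hB⟩ := LeastSquaresForms.exists_bilinear_scalarProduct hEhat hShat what
  refine iSup₂_le fun R hR => ?_
  have hR' := hR.push hφ.symm (hφ.isCompact hEhat)
  set R' := R.push φ.symm
  obtain ⟨b, hb⟩ := hR'.exists_linearMap_avg hEhat
  choose a ha using fun i => (hShat i).exists_linearMap_avg hEhat
  have hη' : ∀ h l, B (LeastSquaresForms.pullback k hφ (η h))
      (LeastSquaresForms.pullback k hφ (η l)) = if h = l then 1 else 0 := fun h l => by
    rw [hB, ← LeastSquaresForms.scalarProduct_push hφ hEhat hShat]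
    exact hη.orthonormal h l
  have hspan : Submodule.span ℝ (Set.range fun h => LeastSquaresForms.pullback k hφ (η h)) =
      Submodule.span ℝ (Set.range ηhat) := by
    rw [hηhat.span_eq, ← hη.span_eq, Submodule.map_span, ← Set.range_comp]
    rfl
  have hRpos := hR.vol_pos
  have hR'pos := hR'.vol_pos
  have hbR : ∀ ω : LeastSquaresForms.Form k E, LeastSquaresForms.avg R ω =
      LeastSquaresForms.vol R' / LeastSquaresForms.vol R *
        b (LeastSquaresForms.pullback k hφ ω) := fun ω => by
    have h1 := LeastSquaresForms.avg_push hφ.symm hR (LeastSquaresForms.pullback k hφ ω)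
    rw [LeastSquaresForms.pullback_symm_pullback] at h1
    change LeastSquaresForms.avg R' _ =
      LeastSquaresForms.vol R / LeastSquaresForms.vol R' * _ at h1
    rw [hb, h1]
    field_simp
  have hkernel : ∀ i, ∑ h, LeastSquaresForms.avg ((Shat i).push φ) (η h) *
      LeastSquaresForms.avg R (η h) =
      LeastSquaresForms.vol (Shat i) / LeastSquaresForms.vol ((Shat i).push φ) *
        (LeastSquaresForms.vol R' / LeastSquaresForms.vol R) *
        ∑ h, LeastSquaresForms.avg (Shat i) (ηhat h) * LeastSquaresForms.avg R' (ηhat h) :=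
    fun i => by
    -- The pulled-back basis may be replaced by `ηhat`, both being orthonormal with the same span.
    have h1 := LeastSquaresForms.sum_mul_eq_of_orthonormal B
      (fun v w => by rw [hB, hB, LeastSquaresForms.scalarProduct_comm]) hη'
      (fun h l => by rw [hB]; exact hηhat.orthonormal h l) hspan (a i) b
    simp only [← hb, ← ha]
    rw [← h1, Finset.mul_sum]
    refine Finset.sum_congr rfl fun h _ => ?_
    rw [LeastSquaresForms.avg_push hφ (hShat i), hbR, ha]
    ring
  have hnonneg : ∀ i, 0 ≤
      |∑ h, LeastSquaresForms.avg (Shat i) (ηhat h) * LeastSquaresForms.avg R' (ηhat h)| *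
        what i := fun i => mul_nonneg (abs_nonneg _) (hwhat i).le
  -- The kernel consumes one of the two volume ratios of `Sᵢ` in the weight; one survives.
  have hterm : ∀ i, |∑ h, LeastSquaresForms.avg ((Shat i).push φ) (η h) *
      LeastSquaresForms.avg R (η h)| * LeastSquaresForms.pushWeight φ (Shat i) (what i) =
      LeastSquaresForms.vol ((Shat i).push φ) / LeastSquaresForms.vol (Shat i) *
        (LeastSquaresForms.vol R' / LeastSquaresForms.vol R) *
        (|∑ h, LeastSquaresForms.avg (Shat i) (ηhat h) * LeastSquaresForms.avg R' (ηhat h)| *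
          what i) := fun i => by
    have h1 := (hShat i).vol_pos
    have h2 := ((hShat i).push hφ hEhat).vol_pos
    rw [hkernel, abs_mul, abs_of_pos (by positivity), LeastSquaresForms.pushWeight]
    field_simp
  have hpos : ∀ i, 0 ≤ LeastSquaresForms.vol ((Shat i).push φ) / LeastSquaresForms.vol (Shat i) :=
    fun i => (div_pos ((hShat i).push hφ hEhat).vol_pos (hShat i).vol_pos).le
  have hposR : 0 ≤ LeastSquaresForms.vol R' / LeastSquaresForms.vol R :=
    (div_pos hR'pos hRpos).le
  rw [div_eq_mul_inv, inv_inv]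
  simp only [hterm]
  refine le_trans ?_
    (mul_le_mul_right (le_iSup₂ (f := fun (R : LeastSquaresForms.KSet n k)
      (_ : R.IsOrientedRectifiable Ehat) => ENNReal.ofReal (∑ i,
        |∑ h, LeastSquaresForms.avg (Shat i) (ηhat h) *
          LeastSquaresForms.avg R (ηhat h)| * what i)) R' hR') _)
  rw [ENNReal.ofReal_sum_of_nonneg
      fun i _ => mul_nonneg (mul_nonneg (hpos i) hposR) (hnonneg i),
    ENNReal.ofReal_sum_of_nonneg fun i _ => hnonneg i, Finset.mul_sum]
  refine Finset.sum_le_sum fun i _ => ?_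
  rw [ENNReal.ofReal_mul (mul_nonneg (hpos i) hposR), ENNReal.ofReal_mul (hpos i)]
  exact mul_le_mul_left (mul_le_mul' (LeastSquaresForms.vol_push_le hφ hEhat (hShat i))
    (LeastSquaresForms.vol_push_symm_le hk hφ hEhat hR)) _
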